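/- Let $k$ be a field, $n\ge 1$ an integer, and let $\mathcal C$ be a $k$-linear Hom-finite $(n+2)$-angulated category (in the sense of Geiss–Keller–Oppermann) with split idempotents and $n$-suspension functor $\Sigma^n$. For an object $X$, $\operatorname{add}X$ denotes the direct summands of finite direct sums of copies of $X$; $X$ is $n$-rigid if $\operatorname{Hom}_{\mathcal C}(X,\Sigma^nX)=0$. Let $T\in\mathcal C$ be an Oppermann–Thomas cluster tilting object, that is, $T$ is $n$-rigid and every $X\in\mathcal C$ admits an $(n+2)$-angle $T_0\to T_1\to\cdots\to T_n\to X\to\Sigma^nT_0$ with all $T_i\in\operatorname{add}T$. Put $\Lambda=\operatorname{End}_{\mathcal C}(T)$, let $\operatorname{mod}\Lambda$ be the category of finite dimensional right $\Lambda$-modules, $\operatorname{proj}\Lambda$ its full subcategory of projective modules, and $\mathcal D\subseteq\operatorname{mod}\Lambda$ the essential image of $\mathcal C(T,-)\colon\mathcal C\to\operatorname{mod}\Lambda$. For $M\in\operatorname{mod}\Lambda$ with minimal projective resolution $\cdots\to P_n\xrightarrow{d_n}P_{n-1}\to\cdots\to P_0\to M\to 0$ let $$\tau_nM=\ker\bigl(D\operatorname{Hom}_\Lambda(P_n,\Lambda)\to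 D\operatorname{Hom}_\Lambda(P_{n-1},\Lambda)\bigr),\qquad D=\operatorname{Hom}_k(-,k),$$ the map being induced by $d_n$. Let $M\in\mathcal D$ and $P\in\operatorname{proj}\Lambda$. * $(M,P)$ is a $\tau_n$-rigid pair if $\operatorname{Hom}_\Lambda(M,\tau_nM)=0$ and $\operatorname{Hom}_\Lambda(P,M)=0$. * $(M,P)$ is a maximal $\tau_n$-rigid pair if (i) for every $N\in\mathcal D$, $N\in\operatorname{add}M$ if and only if $\operatorname{Hom}_\Lambda(M,\tau_nN)=0$, $\operatorname{Hom}_\Lambda(N,\tau_nM)=0$ and $\operatorname{Hom}_\Lambda(P,N)=0$; and (ii) for every $Q\in\operatorname{proj}\Lambda$, $Q\in\operatorname{add}P$ if and only if $\operatorname{Hom}_\Lambda(Q,M)=0$. * $(M,P)$ is a support $\tau_n$-tilting pair if it is a $\tau_n$-rigid pair such that (i) for every $N\in\mathcal D$, if $(M\oplus N,P)$ is a $\tau_n$-rigid pair then $N\in\operatorname{add}M$; and (ii) for every $Q\in\operatorname{proj}\Lambda$, $Q\in\operatorname{add}P$ if and only if $\operatorname{Hom}_\Lambda(Q,M)=0$.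 **Lemma.** If every indecomposable object of $\mathcal C$ is $n$-rigid, then the support $\tau_n$-tilting pairs in $\mathcal D$ are exactly the maximal $\tau_n$-rigid pairs in $\mathcal D$. -/

import Mathlib

open CategoryTheory CategoryTheory.Limits

universe w v u

noncomputable section

/-! ### Finite dimensional modules and the higher Auslander-Reiten translation

Throughout, `R` is a finite dimensional algebra over a field `k`, modules are left `R`-modules,
and `FGModuleCat R` is the category of finitely generated (equivalently, finite dimensional)
`R`-modules.  Right modules over an algebra `A` are left modules over `Aᵐᵒᵖ`. -/

section Modules

/-- `N ∈ add M` for modules: `N` is a direct summand of a finite direct sum of copies of `M`. -/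
def ModInAdd (R : Type v) [Ring R] (N M : FGModuleCat.{v} R) : Prop :=
  ∃ (m : ℕ) (s : N →ₗ[R] (Fin m → M)) (r : (Fin m → M) →ₗ[R] N), r ∘ₗ s = LinearMap.id

/-- `Hom_R(M, N) = 0`. -/
def HomZero (R : Type v) [Ring R] (M N : Type*) [AddCommGroup M] [Module R M]
    [AddCommGroup N] [Module R N] : Prop :=
  ∀ f : M →ₗ[R] N, f = 0

/-- A submodule `K` of `P` is superfluous if `N + K = P` implies `N = P`. -/
def Superfluous {R : Type v} [Ring R] {P : Type*} [AddCommGroup P] [Module R P]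
    (K : Submodule R P) : Prop :=
  ∀ N : Submodule R P, N ⊔ K = ⊤ → N = ⊤

/-- A minimal projective resolution
`⋯ ⟶ X 2 ⟶ X 1 ⟶ X 0 ⟶ M ⟶ 0` by finitely generated projective modules: every term is a
projective cover of the image of the next map. -/
structure MinimalProjectiveResolution {R : Type v} [Ring R] (M : FGModuleCat.{v} R) where
  /-- the projective modules -/
  X : ℕ → FGModuleCat.{v} R
  /-- the differentials -/
  d : ∀ i : ℕ, X (i + 1) →ₗ[R] X i
  /-- the augmentation -/
  ε : X 0 →ₗ[R] M
  projective : ∀ i, Module.Projective R (X i)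
  exact : ∀ i, Function.Exact (d (i + 1)) (d i)
  exact_zero : Function.Exact (d 0) ε
  surjective : Function.Surjective ε
  minimal : ∀ i, Superfluous (LinearMap.range (d i))

/-- Every finitely generated module over a finite dimensional algebra has a projective cover. -/
theorem exists_projectiveCover (k : Type w) [Field k] {R : Type v} [Ring R] [Algebra k R]
    [Module.Finite k R] (M : FGModuleCat.{v} R) :
    ∃ (P : FGModuleCat.{v} R) (p : P →ₗ[R] M), Module.Projective R P ∧
      Function.Surjective p ∧ Superfluous (LinearMap.ker p) := by
  have : IsNoetherianRing R := IsNoetherianRing.of_finite k R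
  have : IsArtinianRing R := IsArtinianRing.of_finite k R
  let S : Set ℕ∞ := {l | ∃ (P : FGModuleCat.{v} R) (p : P →ₗ[R] M), Module.Projective R P ∧
      Function.Surjective p ∧ Module.length R P = l}
  have hS : S.Nonempty := by
    obtain ⟨m, f, hf⟩ := Module.Finite.exists_fin' R M
    exact ⟨_, FGModuleCat.of R (Fin m → R), f, inferInstanceAs (Module.Projective R (Fin m → R)),
      hf, rfl⟩
  obtain ⟨P, p, hP, hp, hl⟩ := wellFounded_lt.min_mem S hS
  refine ⟨P, p, hP, hp, fun N hN => ?_⟩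
  have hsurj : Function.Surjective (p ∘ₗ N.subtype) := by
    intro y
    obtain ⟨x, rfl⟩ := hp y
    have hx : x ∈ N ⊔ LinearMap.ker p := hN ▸ Submodule.mem_top
    obtain ⟨a, ha, b, hb, rfl⟩ := Submodule.mem_sup.1 hx
    refine ⟨⟨a, ha⟩, ?_⟩
    have : p b = 0 := hb
    simp [this]
  obtain ⟨g, hg⟩ := Module.projective_lifting_property (p ∘ₗ N.subtype) p hsurj
  let e : Module.End R P := N.subtype ∘ₗ g
  have he : p ∘ₗ e = p := hg
  have hem : ∀ m : ℕ, p ∘ₗ (e ^ m) = p := by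
    intro m
    induction m with
    | zero => rfl
    | succ m ih =>
      rw [pow_succ, Module.End.mul_eq_comp, ← LinearMap.comp_assoc, ih, he]
  obtain ⟨m, hm, hm1⟩ := (e.eventually_isCompl_ker_pow_range_pow.and
    (Filter.eventually_ge_atTop 1)).exists
  let Q : Submodule R P := LinearMap.range (e ^ m)
  have hQN : Q ≤ N := by
    rintro _ ⟨x, rfl⟩
    obtain ⟨j, rfl⟩ : ∃ j, m = j + 1 := ⟨m - 1, by omega⟩
    rw [pow_succ', Module.End.mul_apply]
    exact (g ((e ^ j) x)).2
  have hQproj : Module.Projective R Q :=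
    Module.Projective.of_split Q.subtype (Submodule.projectionOnto _ _ hm.symm)
      (by ext x; simp)
  have hQs : Function.Surjective (p ∘ₗ Q.subtype) := by
    intro y
    obtain ⟨x, rfl⟩ := hp y
    exact ⟨⟨(e ^ m) x, x, rfl⟩, LinearMap.congr_fun (hem m) x⟩
  have hle : Module.length R P ≤ Module.length R Q := by
    rw [hl]
    exact wellFounded_lt.min_le (s := S)
      ⟨FGModuleCat.of R Q, p ∘ₗ Q.subtype, hQproj, hQs, rfl⟩
  have hQtop : Q = ⊤ := by
    by_contra hne
    exact absurd hle (not_le.2 (Submodule.length_lt hne))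
  exact top_le_iff.1 (hQtop ▸ hQN)

/-- Minimal projective resolutions exist. -/
theorem nonempty_minimalProjectiveResolution (k : Type w) [Field k] {R : Type v} [Ring R]
    [Algebra k R] [Module.Finite k R] (M : FGModuleCat.{v} R) :
    Nonempty (MinimalProjectiveResolution M) := by
  have : IsNoetherianRing R := IsNoetherianRing.of_finite k R
  choose P p hP hp hs using fun M : FGModuleCat.{v} R => exists_projectiveCover k M
  let Ω : ℕ → FGModuleCat.{v} R := fun i =>
    Nat.rec M (fun _ N => FGModuleCat.of R (LinearMap.ker (p N))) i
  let ι : ∀ i, Ω (i + 1) →ₗ[R] P (Ω i) := fun i => (LinearMap.ker (p (Ω i))).subtype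
  have hι : ∀ i, LinearMap.range (ι i) = LinearMap.ker (p (Ω i)) := fun i =>
    Submodule.range_subtype _
  have hιi : ∀ i, Function.Injective (ι i) := fun i => Submodule.injective_subtype _
  have hr : ∀ i, LinearMap.range (ι i ∘ₗ p (Ω (i + 1))) = LinearMap.ker (p (Ω i)) := fun i => by
    rw [LinearMap.range_comp_of_range_eq_top _ (LinearMap.range_eq_top.2 (hp _)), hι]
  refine ⟨⟨fun i => P (Ω i), fun i => ι i ∘ₗ p (Ω (i + 1)), p (Ω 0), fun i => hP _, fun i => ?_,
    ?_, hp _, fun i => ?_⟩⟩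
  · rw [LinearMap.exact_iff, hr (i + 1), LinearMap.ker_comp_of_ker_eq_bot _ (LinearMap.ker_eq_bot.2 (hιi i))]
  · rw [LinearMap.exact_iff, hr]
  · rw [hr]
    exact hs _

/-- The Nakayama functor on objects: `ν P = D Hom_R(P, R)` with `D = Hom_k(-, k)`. -/
def Nakayama (k : Type w) [Field k] (R : Type v) [Ring R] [Algebra k R]
    (P : Type v) [AddCommGroup P] [Module R P] : Type (max v w) :=
  Module.Dual k (P →ₗ[R] R)

namespace Nakayama

variable (k : Type w) [Field k] (R : Type v) [Ring R] [Algebra k R]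
  (P : Type v) [AddCommGroup P] [Module R P] {Q : Type v} [AddCommGroup Q] [Module R Q]

instance : AddCommGroup (Nakayama k R P) :=
  inferInstanceAs (AddCommGroup (Module.Dual k (P →ₗ[R] R)))

/-- Right multiplication by `r` on `Hom_R(P, R)`, that is, `f ↦ (x ↦ f x * r)`. -/
def rightMul (r : R) : (P →ₗ[R] R) →ₗ[k] (P →ₗ[R] R) where
  toFun f :=
    { toFun := fun x => f x * r
      map_add' := fun x y => by rw [map_add, add_mul]
      map_smul' := fun a x => by simp [mul_assoc] }
  map_add' f g := by ext x; simp [add_mul]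
  map_smul' a f := by ext x; simp

/-- `R` acts on `ν P = D Hom_R(P, R)` by `(r • φ) f = φ (f r)`. -/
instance : Module R (Nakayama k R P) where
  smul r φ := LinearMap.comp (show (P →ₗ[R] R) →ₗ[k] k from φ) (rightMul k R P r)
  one_smul φ := LinearMap.ext fun f =>
    congrArg (show (P →ₗ[R] R) →ₗ[k] k from φ) (LinearMap.ext fun x => mul_one (f x))
  mul_smul r s φ := LinearMap.ext fun f =>
    congrArg (show (P →ₗ[R] R) →ₗ[k] k from φ)
      (LinearMap.ext fun x => (mul_assoc (f x) r s).symm)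
  smul_zero _ := rfl
  smul_add _ _ _ := rfl
  add_smul r s φ := LinearMap.ext fun f =>
    (congrArg (show (P →ₗ[R] R) →ₗ[k] k from φ)
      (LinearMap.ext fun x => mul_add (f x) r s :
        rightMul k R P (r + s) f = rightMul k R P r f + rightMul k R P s f)).trans
      (map_add (show (P →ₗ[R] R) →ₗ[k] k from φ) _ _)
  zero_smul φ := LinearMap.ext fun f =>
    (congrArg (show (P →ₗ[R] R) →ₗ[k] k from φ)
      (LinearMap.ext fun x => mul_zero (f x) : rightMul k R P 0 f = 0)).trans
      (map_zero (show (P →ₗ[R] R) →ₗ[k] k from φ))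

variable {P}

/-- The Nakayama functor on morphisms: `(ν g φ) f = φ (f ∘ g)`. -/
def map (g : P →ₗ[R] Q) : Nakayama k R P →ₗ[R] Nakayama k R Q where
  toFun φ := LinearMap.comp (show (P →ₗ[R] R) →ₗ[k] k from φ)
    (show (Q →ₗ[R] R) →ₗ[k] (P →ₗ[R] R) from
      { toFun := fun f => f ∘ₗ g
        map_add' := fun _ _ => rfl
        map_smul' := fun _ _ => rfl })
  map_add' _ _ := rfl
  map_smul' _ _ := rfl

end Nakayama

variable (k : Type w) [Field k] {R : Type v} [Ring R] [Algebra k R] [Module.Finite k R]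

/-- A chosen minimal projective resolution of `M`. -/
def minimalResolution (M : FGModuleCat.{v} R) : MinimalProjectiveResolution M :=
  Classical.choice (nonempty_minimalProjectiveResolution k M)

/-- The `n`-Auslander-Reiten translation (`1 ≤ n`): `τ_n M = Ker (ν P_n ⟶ ν P_{n-1})`, where
`P_n ⟶ P_{n-1} ⟶ ⋯ ⟶ P_0 ⟶ M ⟶ 0` is a minimal projective resolution of `M`. -/
def higherTau (n : ℕ) (M : FGModuleCat.{v} R) :
    Submodule R (Nakayama k R ((minimalResolution k M).X (n - 1 + 1))) :=
  LinearMap.ker (Nakayama.map k R ((minimalResolution k M).d (n - 1)))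

/-- `M` is `τ_n`-rigid: `Hom(M, τ_n M) = 0`. -/
def IsTauRigid (n : ℕ) (M : FGModuleCat.{v} R) : Prop :=
  HomZero R M (higherTau k n M)

/-- `(M, P)` is a `τ_n`-rigid pair in `𝒟`: `M ∈ 𝒟` is `τ_n`-rigid, `P` is a (finitely generated)
projective module and `Hom(P, M) = 0`. -/
def IsTauRigidPair (n : ℕ) (𝒟 : ObjectProperty (FGModuleCat.{v} R))
    (M P : FGModuleCat.{v} R) : Prop :=
  𝒟 M ∧ Module.Projective R P ∧ IsTauRigid k n M ∧ HomZero R P M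

/-- `(M, P)` is a maximal `τ_n`-rigid pair in `𝒟`. -/
def IsMaximalTauRigidPair (n : ℕ) (𝒟 : ObjectProperty (FGModuleCat.{v} R))
    (M P : FGModuleCat.{v} R) : Prop :=
  𝒟 M ∧ Module.Projective R P ∧
  (∀ N : FGModuleCat.{v} R, 𝒟 N →
    (ModInAdd R N M ↔
      HomZero R M (higherTau k n N) ∧ HomZero R N (higherTau k n M) ∧ HomZero R P N)) ∧
  (∀ Q : FGModuleCat.{v} R, Module.Projective R Q → (ModInAdd R Q P ↔ HomZero R Q M))

/-- `(M, P)` is a support `τ_n`-tilting pair in `𝒟`. -/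
def IsSupportTauTiltingPair (n : ℕ) (𝒟 : ObjectProperty (FGModuleCat.{v} R))
    (M P : FGModuleCat.{v} R) : Prop :=
  IsTauRigidPair k n 𝒟 M P ∧
  (∀ N : FGModuleCat.{v} R, 𝒟 N →
    IsTauRigidPair k n 𝒟 (FGModuleCat.of R (M × N)) P → ModInAdd R N M) ∧
  (∀ Q : FGModuleCat.{v} R, Module.Projective R Q → (ModInAdd R Q P ↔ HomZero R Q M))

end Modules

/-! ### `(n+2)`-angulated categories -/

section Angulated

variable {C : Type u} [Category.{v} C]

/-- An additive category has binary direct sums. -/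
instance hasBinaryBiproducts_of_hasFiniteBiproducts [HasZeroMorphisms C]
    [HasFiniteBiproducts C] : HasBinaryBiproducts C :=
  hasBinaryBiproducts_of_finite_biproducts C

/-- An `(n+2)`-`Σ`-sequence `X_0 ⟶ X_1 ⟶ ⋯ ⟶ X_{n+1} ⟶ Σ X_0`
(with the terms indexed from `0`, and `S` in the role of `Σ = Σ^n`). -/
structure SigmaSeq (S : C ≌ C) (n : ℕ) where
  /-- the terms `X_0, …, X_{n+1}` -/
  obj : ∀ i : ℕ, i < n + 2 → C
  /-- the maps `α_i : X_i ⟶ X_{i+1}` for `0 ≤ i ≤ n` -/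
  map : ∀ (i : ℕ) (hi : i < n + 1), obj i (by omega) ⟶ obj (i + 1) (by omega)
  /-- the map `α_{n+1} : X_{n+1} ⟶ Σ X_0` -/
  last : obj (n + 1) (by omega) ⟶ S.functor.obj (obj 0 (by omega))

namespace SigmaSeq

variable {S : C ≌ C} {n : ℕ}

/-- Morphisms of `(n+2)`-`Σ`-sequences. -/
structure Hom (X Y : SigmaSeq S n) where
  /-- the components -/
  app : ∀ (i : ℕ) (hi : i < n + 2), X.obj i hi ⟶ Y.obj i hi
  comm : ∀ (i : ℕ) (hi : i < n + 1),
    X.map i hi ≫ app (i + 1) (by omega) = app i (by omega) ≫ Y.map i hi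
  comm_last : X.last ≫ S.functor.map (app 0 (by omega)) = app (n + 1) (by omega) ≫ Y.last

variable [Preadditive C]

/-- `Z` is a direct sum of the sequences `X` and `Y`. -/
def IsDirectSum (Z X Y : SigmaSeq S n) : Prop :=
  ∃ (ι₁ : Hom X Z) (ι₂ : Hom Y Z) (π₁ : Hom Z X) (π₂ : Hom Z Y), ∀ (i : ℕ) (hi : i < n + 2),
    ι₁.app i hi ≫ π₁.app i hi = 𝟙 _ ∧ ι₂.app i hi ≫ π₂.app i hi = 𝟙 _ ∧
    ι₁.app i hi ≫ π₂.app i hi = 0 ∧ ι₂.app i hi ≫ π₁.app i hi = 0 ∧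
    π₁.app i hi ≫ ι₁.app i hi + π₂.app i hi ≫ ι₂.app i hi = 𝟙 _

/-- `X` is isomorphic to a trivial sequence `A ⟶ A ⟶ 0 ⟶ ⋯ ⟶ 0 ⟶ Σ A` (with first map the
identity of `A`). -/
def IsTrivial (X : SigmaSeq S n) : Prop :=
  IsIso (X.map 0 (by omega)) ∧ ∀ (i : ℕ) (hi : i < n + 2), 2 ≤ i → IsZero (X.obj i hi)

/-- `Y` is (isomorphic to) the left rotation of `X`: the sequence
`X_1 ⟶ X_2 ⟶ ⋯ ⟶ X_{n+1} ⟶ Σ X_0 ⟶ Σ X_1` with maps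
`α_1, …, α_n, α_{n+1}, (-1)^{n+2} Σ α_0`. -/
def IsLeftRotation (X Y : SigmaSeq S n) : Prop :=
  ∃ (e : ∀ (i : ℕ) (hi : i < n + 1), Y.obj i (by omega) ≅ X.obj (i + 1) (by omega))
    (e' : Y.obj (n + 1) (by omega) ≅ S.functor.obj (X.obj 0 (by omega))),
    (∀ (i : ℕ) (hi : i < n),
      Y.map i (by omega) ≫ (e (i + 1) (by omega)).hom =
        (e i (by omega)).hom ≫ X.map (i + 1) (by omega)) ∧
    Y.map n (by omega) ≫ e'.hom = (e n (by omega)).hom ≫ X.last ∧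
    Y.last ≫ S.functor.map (e 0 (by omega)).hom =
      e'.hom ≫ ((-1 : ℤ) ^ (n + 2) • S.functor.map (X.map 0 (by omega)))

variable [HasFiniteBiproducts C]

/-- `Z` is (isomorphic to) the mapping cone of `φ : X ⟶ Y`: the sequence
`X_1 ⊕ Y_0 ⟶ X_2 ⊕ Y_1 ⟶ ⋯ ⟶ X_{n+1} ⊕ Y_n ⟶ Σ X_0 ⊕ Y_{n+1} ⟶ Σ X_1 ⊕ Σ Y_0` whose maps are
the matrices with rows `(-α, 0)` and `(φ, β)`.  (`Biprod.ofComponents f₁₁ f₁₂ f₂₁ f₂₂` has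
components `f_{ij}` from the `i`-th summand to the `j`-th one.) -/
def IsCone {X Y : SigmaSeq S n} (φ : Hom X Y) (Z : SigmaSeq S n) : Prop :=
  ∃ (e : ∀ (i : ℕ) (hi : i < n + 1),
      Z.obj i (by omega) ≅ X.obj (i + 1) (by omega) ⊞ Y.obj i (by omega))
    (e' : Z.obj (n + 1) (by omega) ≅
      S.functor.obj (X.obj 0 (by omega)) ⊞ Y.obj (n + 1) (by omega)),
    (∀ (i : ℕ) (hi : i < n),
      Z.map i (by omega) ≫ (e (i + 1) (by omega)).hom =
        (e i (by omega)).hom ≫ Biprod.ofComponents (-(X.map (i + 1) (by omega)))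
          (φ.app (i + 1) (by omega)) 0 (Y.map i (by omega))) ∧
    Z.map n (by omega) ≫ e'.hom =
      (e n (by omega)).hom ≫ Biprod.ofComponents (-X.last)
        (φ.app (n + 1) (by omega)) 0 (Y.map n (by omega)) ∧
    Z.last ≫ S.functor.map (e 0 (by omega)).hom =
      e'.hom ≫ Biprod.ofComponents (-(S.functor.map (X.map 0 (by omega))))
          (S.functor.map (φ.app 0 (by omega))) 0 Y.last ≫
        biprod.desc (S.functor.map biprod.inl) (S.functor.map biprod.inr)

end SigmaSeq

variable (C) [Preadditive C] [HasFiniteBiproducts C]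

/-- An `(n+2)`-angulated structure on an additive category in the sense of
Geiss, Keller and Oppermann: an autoequivalence `Σ` and a class of `(n+2)`-`Σ`-sequences, the
`(n+2)`-angles, satisfying the axioms (F1)-(F4). -/
structure Angulation (n : ℕ) where
  /-- the `n`-suspension functor -/
  S : C ≌ C
  /-- the class of `(n+2)`-angles -/
  angles : Set (SigmaSeq S n)
  /-- (F1a) the class is closed under direct sums and direct summands (hence, with (F1b),
  under isomorphisms) -/
  directSum_iff : ∀ Z X Y : SigmaSeq S n, Z.IsDirectSum X Y →
    (Z ∈ angles ↔ X ∈ angles ∧ Y ∈ angles)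
  /-- (F1b) trivial sequences are angles -/
  trivial_mem : ∀ X : SigmaSeq S n, X.IsTrivial → X ∈ angles
  /-- (F1c) every morphism is the first map of an angle -/
  exists_angle : ∀ {A B : C} (f : A ⟶ B), ∃ X ∈ angles,
    ∃ (e₀ : X.obj 0 (by omega) ≅ A) (e₁ : X.obj (0 + 1) (by omega) ≅ B),
      X.map 0 (by omega) ≫ e₁.hom = e₀.hom ≫ f
  /-- (F2) a sequence is an angle if and only if its left rotation is -/
  rotate_iff : ∀ X Y : SigmaSeq S n, X.IsLeftRotation Y → (X ∈ angles ↔ Y ∈ angles)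
  /-- (F3) and (F4): every commutative square between the first maps of two angles extends to a
  morphism of angles, which can be chosen in such a way that its mapping cone is an angle -/
  exists_hom : ∀ X ∈ angles, ∀ Y ∈ angles,
    ∀ (f₀ : X.obj 0 (by omega) ⟶ Y.obj 0 (by omega))
      (f₁ : X.obj (0 + 1) (by omega) ⟶ Y.obj (0 + 1) (by omega)),
      X.map 0 (by omega) ≫ f₁ = f₀ ≫ Y.map 0 (by omega) →
      ∃ φ : SigmaSeq.Hom X Y, φ.app 0 (by omega) = f₀ ∧ φ.app (0 + 1) (by omega) = f₁ ∧
        ∃ Z ∈ angles, SigmaSeq.IsCone φ Z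

variable {C}

/-- `X ∈ add M`: `X` is a direct summand of a finite direct sum of copies of `M`. -/
def InAdd (X M : C) : Prop :=
  ∃ m : ℕ, Nonempty (Retract X (⨁ fun _ : Fin m => M))

namespace Angulation

variable {n : ℕ} (𝒜 : Angulation C n)

/-- `X` is `n`-rigid: `Hom(X, Σ^n X) = 0`. -/
def IsRigid (X : C) : Prop :=
  ∀ f : X ⟶ 𝒜.S.functor.obj X, f = 0

/-- Oppermann-Thomas cluster tilting objects: `T` is `n`-rigid and every object `X` fits into an
`(n+2)`-angle `T_0 ⟶ T_1 ⟶ ⋯ ⟶ T_n ⟶ X ⟶ Σ^n T_0` with all `T_i ∈ add T`. -/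
def IsClusterTilting (T : C) : Prop :=
  𝒜.IsRigid T ∧ ∀ X : C, ∃ Z ∈ 𝒜.angles,
    (∀ (i : ℕ) (hi : i ≤ n), InAdd (Z.obj i (by omega)) T) ∧
    Nonempty (Z.obj (n + 1) (by omega) ≅ X)

end Angulation

end Angulated

/-! ### The functor `C(T, -) : C ⥤ mod Λ` -/

section HomFunctor

variable (k : Type w) [Field k] {C : Type u} [Category.{v} C] [Preadditive C] [Linear k C]

/-- In a Hom-finite category the algebra `Λᵐᵒᵖ`, `Λ = End(T)`, is finite dimensional. -/
instance finite_end_op [h : ∀ X Y : C, Module.Finite k (X ⟶ Y)] (T : C) :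
    Module.Finite k (End T)ᵐᵒᵖ :=
  haveI : Module.Finite k (End T) := h T T
  Module.Finite.equiv (MulOpposite.opLinearEquiv k)

theorem finite_hom [∀ X Y : C, Module.Finite k (X ⟶ Y)] (T X : C) :
    Module.Finite (End T)ᵐᵒᵖ (T ⟶ X) := by
  obtain ⟨s, hs⟩ := Module.Finite.fg_top (R := k) (M := T ⟶ X)
  refine ⟨⟨s, top_le_iff.1 fun x _ => ?_⟩⟩
  have hx : x ∈ Submodule.span k (s : Set (T ⟶ X)) := hs ▸ Submodule.mem_top
  refine Submodule.span_induction (fun y hy => Submodule.subset_span hy)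
    (Submodule.zero_mem _) (fun _ _ _ _ => Submodule.add_mem _) (fun a y _ hy => ?_) hx
  have hay : a • y = (a • 𝟙 T) ≫ y := by simp
  rw [hay]
  exact Submodule.smul_mem _ (show (End T)ᵐᵒᵖ from MulOpposite.op (a • 𝟙 T)) hy

/-- The functor `C(T, -)` from `C` to the category `mod Λ` of finitely generated right modules
over `Λ = End(T)`, that is, of finitely generated left `Λᵐᵒᵖ`-modules. -/
def homFunctor [∀ X Y : C, Module.Finite k (X ⟶ Y)] (T : C) :
    C ⥤ FGModuleCat.{v} (End T)ᵐᵒᵖ :=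
  (ModuleCat.isFG.{v} (End T)ᵐᵒᵖ).lift (preadditiveCoyonedaObj T) fun X => finite_hom k T X

end HomFunctor

end

/-! Maximal pairs are support `τ_n`-tilting for formal reasons. In the converse direction, a module
`A` in `𝒟` satisfying the three vanishing conditions of a maximal pair need not be `τ_n`-rigid, so
`M × A` cannot be tested directly. Instead write `A = C(T, X)` and decompose `X` into
indecomposables `X_j`. Each `C(T, X_j)` is `τ_n`-rigid and inherits the three conditions as a
summand of `A`, so adding it alone to `M` keeps the pair rigid. Hence it lies in `add M`, and so
does `A`. No vanishing between different summands is needed. This is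
`IsSupportTauTiltingPair.isMaximalTauRigidPair`, fed by `exists_indecomposable_decomposition`.

It remains to see that `n`-rigid objects give `τ_n`-rigid modules
(`Angulation.IsClusterTilting.isTauRigid`). Since `Hom(M, ν P)` is dual to `Hom(P, M)` for `P`
finitely generated projective, `Hom(M, τ_n N) = 0` says that every map `P_n ⟶ M` factors through
`P_n ⟶ P_{n-1}` (`Nakayama.homZero_ker_map_iff`). Applying `C(T, -)` to an angle `T_0 ⟶ ⋯ ⟶ T_n ⟶ X
⟶ Σ T_0` yields the start of a projective resolution of `C(T, X)`, usually not minimal;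
`MinimalProjectiveResolution.factors_of_sum` transfers the factorization property to the minimal
one. By Yoneda, the property asks that every `T_0 ⟶ X` factor through `T_0 ⟶ T_1`. The obstruction
is the composite `X ⟶ Σ T_0 ⟶ Σ X`, which is zero when `X` is rigid. -/

noncomputable section

section Modules

/-! ### Homs into the higher Auslander-Reiten translation -/

/-- A finitely generated projective module has a finite dual basis. -/
theorem exists_dual_basis {R : Type*} [Ring R] (P : Type*) [AddCommGroup P] [Module R P]
    [Module.Finite R P] [Module.Projective R P] :
    ∃ (m : ℕ) (p : Fin m → P) (c : Fin m → (P →ₗ[R] R)), ∀ x, ∑ j, c j x • p j = x := by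
  obtain ⟨m, f, g, -, -, h⟩ := Module.Finite.exists_comp_eq_id_of_projective R P
  refine ⟨m, fun j => f (Pi.single j 1), fun j => LinearMap.proj j ∘ₗ g, fun x => ?_⟩
  calc ∑ j, g x j • f (Pi.single j 1) = f (∑ j, g x j • Pi.single j 1) := by simp
    _ = f (g x) := by
      congr 1
      ext i
      simp [Pi.single_apply]
    _ = x := LinearMap.congr_fun h x

namespace Nakayama

variable (k : Type w) [Field k] {R : Type v} [Ring R] [Algebra k R]
  {P : Type v} [AddCommGroup P] [Module R P] {Q : Type v} [AddCommGroup Q] [Module R Q]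

/-- The linear form on `Hom_R(P, R)` underlying an element of `ν P`. -/
def form : Nakayama k R P →+ ((P →ₗ[R] R) →ₗ[k] k) where
  toFun φ := φ
  map_zero' := rfl
  map_add' _ _ := rfl

variable {k}

theorem form_smul (r : R) (φ : Nakayama k R P) (f : P →ₗ[R] R) :
    form k (r • φ) f = form k φ (rightMul k R P r f) := rfl

theorem form_map (g : P →ₗ[R] Q) (φ : Nakayama k R P) (f : Q →ₗ[R] R) :
    form k (map k R g φ) f = form k φ (f ∘ₗ g) := rfl

theorem form_ext {φ ψ : Nakayama k R P} (h : ∀ f, form k φ f = form k ψ f) : φ = ψ :=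
  LinearMap.ext h

section OfForm

variable {M : Type v} [AddCommGroup M] [Module R M] [Module k M] [SMulCommClass R k M]
  [IsScalarTower k R M]

/-- The map `M ⟶ ν P` given by a linear form on `Hom_R(P, M)`. -/
def ofForm (l : (P →ₗ[R] M) →ₗ[k] k) : M →ₗ[R] Nakayama k R P where
  toFun m :=
    { toFun := fun f => l (f.smulRight m)
      map_add' := fun f g => by
        rw [← map_add]; congr 1; ext x; simp [add_smul]
      map_smul' := fun a f => by
        rw [← map_smul]; congr 1; ext x; simp }
  map_add' m m' := form_ext fun f => by
    change l _ = l _ + l _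
    rw [← map_add]; congr 1; ext x; simp
  map_smul' r m := form_ext fun f => by
    change l _ = l _
    congr 1; ext x; simp [rightMul, mul_smul]

theorem form_ofForm (l : (P →ₗ[R] M) →ₗ[k] k) (m : M) (f : P →ₗ[R] R) :
    form k (ofForm l m) f = l (f.smulRight m) := rfl

end OfForm

/-- `Hom(M, Ker (ν P ⟶ ν Q)) = 0` if and only if every map `P ⟶ M` factors through `P ⟶ Q`. -/
theorem homZero_ker_map_iff [Module.Finite R P] [Module.Projective R P] [Module.Finite R Q]
    [Module.Projective R Q] (d : P →ₗ[R] Q) (M : Type v) [AddCommGroup M] [Module R M] :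
    HomZero R M (LinearMap.ker (map k R d)) ↔
      ∀ f : P →ₗ[R] M, ∃ g : Q →ₗ[R] M, g ∘ₗ d = f := by
  let : Module k M := Module.compHom M (algebraMap k R)
  have hsm : ∀ (a : k) (m : M), a • m = algebraMap k R a • m := fun _ _ => rfl
  have : SMulCommClass R k M := ⟨fun r a m => by
    rw [hsm, hsm, ← mul_smul, ← mul_smul, Algebra.commutes]⟩
  have : IsScalarTower k R M := ⟨fun a r m => by
    rw [hsm, ← mul_smul, Algebra.smul_def]⟩
  obtain ⟨m, p, c, hp⟩ := exists_dual_basis (R := R) P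
  obtain ⟨m', q, c', hq⟩ := exists_dual_basis (R := R) Q
  let pre : (Q →ₗ[R] M) →ₗ[k] (P →ₗ[R] M) :=
    { toFun := fun g => g ∘ₗ d
      map_add' := fun _ _ => rfl
      map_smul' := fun _ _ => rfl }
  constructor
  · intro h
    by_contra hne
    have hlt : LinearMap.range pre < ⊤ := by
      refine lt_top_iff_ne_top.2 fun htop => hne fun f => ?_
      exact LinearMap.range_eq_top.1 htop f
    -- A nonzero form on `Hom(P, M)` killing all maps that factor through `d` corresponds to a
    -- nonzero map from `M` into the kernel of `ν d`.
    obtain ⟨l, hl0, hl⟩ := Submodule.exists_le_ker_of_lt_top _ hlt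
    let θ : M →ₗ[R] LinearMap.ker (map k R d) :=
      (ofForm l).codRestrict _ fun x => form_ext fun f => by
        rw [form_map, form_ofForm]
        exact hl ⟨f.smulRight x, rfl⟩
    have hθ : ∀ x, ofForm (P := P) l x = 0 := fun x =>
      congrArg Subtype.val (LinearMap.congr_fun (h θ) x)
    refine hl0 (LinearMap.ext fun f => ?_)
    -- By the dual basis, every map out of `P` is a sum of rank one maps, and on these `l` is
    -- determined by `ofForm l`.
    have hf : f = ∑ j, (c j).smulRight (f (p j)) := by
      ext x
      conv_lhs => rw [← hp x]
      simp
    rw [hf, map_sum]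
    refine Finset.sum_eq_zero fun j _ => ?_
    rw [← form_ofForm, hθ]
    rfl
  · intro h θ
    -- This inverts `ofForm`: the form on `Hom(P, M)` recovered from `θ`. It vanishes on every `g ∘
    -- d` because `θ` lands in the kernel of `ν d`, hence everywhere by the factorization
    -- hypothesis.
    let l : (P →ₗ[R] M) → k := fun f => ∑ j, form k (θ (f (p j)) : Nakayama k R P) (c j)
    have hl : ∀ (f : P →ₗ[R] R) (x : M), l (f.smulRight x) = form k (θ x : Nakayama k R P) f := by
      intro f x
      have hf : f = ∑ j, rightMul k R P (f (p j)) (c j) := by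
        ext y
        conv_lhs => rw [← hp y]
        simp [rightMul]
      conv_rhs => rw [hf, map_sum]
      refine Finset.sum_congr rfl fun j _ => ?_
      rw [LinearMap.smulRight_apply, map_smul, Submodule.coe_smul, form_smul]
    have hl0 : ∀ f, l f = 0 := by
      intro f
      obtain ⟨g, rfl⟩ := h f
      have hg : g ∘ₗ d = ∑ i, (c' i ∘ₗ d).smulRight (g (q i)) := by
        ext x
        conv_lhs => rw [LinearMap.comp_apply, ← hq (d x)]
        simp
      have hadd : ∀ f g, l (f + g) = l f + l g := fun f g => by
        simp [l, Finset.sum_add_distrib]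
      let l' : (P →ₗ[R] M) →+ k := AddMonoidHom.mk' l hadd
      change l' _ = 0
      rw [hg, map_sum]
      refine Finset.sum_eq_zero fun i _ => ?_
      change l _ = 0
      rw [hl, ← form_map, show map k R d (θ (g (q i)) : Nakayama k R P) = 0 from (θ (g (q i))).2]
      rfl
    ext x : 2
    exact form_ext fun f => by
      rw [← hl, hl0]
      rfl

end Nakayama

/-! ### Partial projective resolutions -/

/-- The terms `X (m + 1) ⟶ X m ⟶ ⋯ ⟶ X 0 ⟶ M ⟶ 0` of a sequence of finitely generated projective
modules which is exact, except possibly at `X (m + 1)`. -/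
structure PartialResolution {R : Type v} [Ring R] (m : ℕ) (M : FGModuleCat.{v} R) where
  /-- the projective modules -/
  X : ℕ → FGModuleCat.{v} R
  /-- the differentials -/
  d : ∀ i : ℕ, X (i + 1) →ₗ[R] X i
  /-- the augmentation -/
  ε : X 0 →ₗ[R] M
  projective : ∀ i, Module.Projective R (X i)
  exact : ∀ i < m, Function.Exact (d (i + 1)) (d i)
  exact_zero : Function.Exact (d 0) ε
  surjective : Function.Surjective ε

variable {R : Type v} [Ring R]

/-- The truncation of a minimal projective resolution. -/
def MinimalProjectiveResolution.toPartialResolution {M : FGModuleCat.{v} R}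
    (Q : MinimalProjectiveResolution M) (m : ℕ) : PartialResolution m M where
  X := Q.X
  d := Q.d
  ε := Q.ε
  projective := Q.projective
  exact i _ := Q.exact i
  exact_zero := Q.exact_zero
  surjective := Q.surjective

namespace PartialResolution

variable {m : ℕ} {A B : FGModuleCat.{v} R}

/-- Every map `X (m + 1) ⟶ M` factors through `X (m + 1) ⟶ X m`. -/
def Factors (P : PartialResolution m A) (M : FGModuleCat.{v} R) : Prop :=
  ∀ f : P.X (m + 1) →ₗ[R] M, ∃ g : P.X m →ₗ[R] M, g ∘ₗ P.d m = f

/-- A map out of a projective module whose image is contained in that of `g` lifts along `g`. -/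
theorem exists_lift_of_exact {P L M N : Type*} [AddCommGroup P] [Module R P]
    [Module.Projective R P] [AddCommGroup L] [Module R L] [AddCommGroup M] [Module R M]
    [AddCommGroup N] [Module R N] {g : L →ₗ[R] M} {h : M →ₗ[R] N} (e : Function.Exact g h)
    (f : P →ₗ[R] M) (hf : h ∘ₗ f = 0) : ∃ l : P →ₗ[R] L, g ∘ₗ l = f := by
  have hr : ∀ x, f x ∈ LinearMap.range g := fun x => (e (f x)).1 (LinearMap.congr_fun hf x)
  obtain ⟨l, hl⟩ := Module.projective_lifting_property g.rangeRestrict (f.codRestrict _ hr)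
    g.surjective_rangeRestrict
  refine ⟨l, LinearMap.ext fun x => ?_⟩
  exact congrArg Subtype.val (LinearMap.congr_fun hl x)

/-- The comparison theorem for partial projective resolutions. -/
theorem exists_lift (P : PartialResolution m A) (Q : PartialResolution m B) (s : A →ₗ[R] B) :
    ∃ φ : ∀ i, P.X i →ₗ[R] Q.X i, Q.ε ∘ₗ φ 0 = s ∘ₗ P.ε ∧
      ∀ i ≤ m, Q.d i ∘ₗ φ (i + 1) = φ i ∘ₗ P.d i := by
  classical
  have := P.projective
  obtain ⟨φ₀, h₀⟩ := Module.projective_lifting_property Q.ε (s ∘ₗ P.ε) Q.surjective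
  let φ : ∀ i, P.X i →ₗ[R] Q.X i := fun i => Nat.rec φ₀ (fun i ψ =>
    -- The value `0` is a default for degrees where no lift exists; exactness below degree `m`
    -- guarantees lifts up to degree `m + 1`.
    if h : ∃ g, Q.d i ∘ₗ g = ψ ∘ₗ P.d i then h.choose else 0) i
  have hs : ∀ i, (∃ g, Q.d i ∘ₗ g = φ i ∘ₗ P.d i) → Q.d i ∘ₗ φ (i + 1) = φ i ∘ₗ P.d i := by
    intro i h
    have : φ (i + 1) = h.choose := dif_pos h
    rw [this]
    exact h.choose_spec
  refine ⟨φ, h₀, fun i => ?_⟩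
  induction i with
  | zero =>
    intro _
    refine hs 0 (exists_lift_of_exact Q.exact_zero _ ?_)
    rw [← LinearMap.comp_assoc]
    change (Q.ε ∘ₗ φ₀) ∘ₗ _ = 0
    rw [h₀, LinearMap.comp_assoc, P.exact_zero.linearMap_comp_eq_zero, LinearMap.comp_zero]
  | succ i ih =>
    intro hi
    refine hs (i + 1) (exists_lift_of_exact (Q.exact i (by omega)) _ ?_)
    rw [← LinearMap.comp_assoc, ih (by omega), LinearMap.comp_assoc,
      (P.exact i (by omega)).linearMap_comp_eq_zero, LinearMap.comp_zero]

end PartialResolution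

namespace MinimalProjectiveResolution

variable {m : ℕ} {A : FGModuleCat.{v} R}

/-- A surjective endomorphism modulo a superfluous submodule is bijective. -/
theorem _root_.Superfluous.bijective [IsNoetherianRing R] {P : Type*} [AddCommGroup P] [Module R P]
    [Module.Finite R P] {K : Submodule R P} (hK : Superfluous K) (u : P →ₗ[R] P)
    (hu : ∀ x, ∃ y, x - u y ∈ K) : Function.Bijective u := by
  have hs : Function.Surjective u := by
    rw [← LinearMap.range_eq_top]
    refine hK _ (top_le_iff.1 fun x _ => ?_)
    obtain ⟨y, hy⟩ := hu x
    exact Submodule.mem_sup.2 ⟨u y, ⟨y, rfl⟩, _, hy, by abel⟩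
  exact ⟨IsNoetherian.injective_of_surjective_endomorphism u hs, hs⟩

/-- A chain endomorphism of a minimal projective resolution lifting the identity is bijective. -/
theorem bijective_of_lift [IsNoetherianRing R] (Q : MinimalProjectiveResolution A)
    (u : ∀ i, Q.X i →ₗ[R] Q.X i) (h0 : Q.ε ∘ₗ u 0 = Q.ε)
    (h : ∀ i ≤ m, Q.d i ∘ₗ u (i + 1) = u i ∘ₗ Q.d i) :
    ∀ i ≤ m + 1, Function.Bijective (u i) := by
  have h0' : ∀ x, Q.ε (u 0 x) = Q.ε x := LinearMap.congr_fun h0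
  have h' : ∀ i ≤ m, ∀ x, Q.d i (u (i + 1) x) = u i (Q.d i x) :=
    fun i hi => LinearMap.congr_fun (h i hi)
  have b0 : Function.Bijective (u 0) :=
    (Q.minimal 0).bijective _ fun x => ⟨x, (Q.exact_zero _).1 (by rw [map_sub, h0', sub_self])⟩
  -- The induction must also carry that `u i` reflects the image of `d i`. This places the `u
  -- i`-preimage of `d i x` in that image, which gives surjectivity of `u (i + 1)` modulo the
  -- superfluous image of `d (i + 1)`.
  suffices H : ∀ i ≤ m + 1, Function.Bijective (u i) ∧
      ∀ y, u i y ∈ LinearMap.range (Q.d i) → y ∈ LinearMap.range (Q.d i) from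
    fun i hi => (H i hi).1
  intro i
  induction i with
  | zero => exact fun _ => ⟨b0, fun y hy => (Q.exact_zero _).1 (h0' y ▸ (Q.exact_zero _).2 hy)⟩
  | succ i ih =>
    intro hi
    obtain ⟨hb, hr⟩ := ih (by omega)
    refine ⟨(Q.minimal (i + 1)).bijective _ fun x => ?_, fun y hy => (Q.exact i _).1 (hb.1 ?_)⟩
    · obtain ⟨y, hy⟩ := hb.2 (Q.d i x)
      obtain ⟨z, rfl⟩ := hr y ⟨x, by rw [hy]⟩
      exact ⟨z, (Q.exact i _).1 (by rw [map_sub, h' i (by omega), hy, sub_self])⟩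
    · rw [map_zero, ← h' i (by omega)]
      exact (Q.exact i _).2 hy

/-- If `A` is a direct summand of a finite direct sum of modules `N j` which have partial
resolutions such that all maps to `M` factor, then a minimal resolution of `A` has this
property. -/
theorem factors_of_sum [IsNoetherianRing R] (Q : MinimalProjectiveResolution A) {ι : Type*}
    [Fintype ι] {N : ι → FGModuleCat.{v} R} (s : ∀ j, A →ₗ[R] N j) (r : ∀ j, N j →ₗ[R] A)
    (hrs : ∑ j, r j ∘ₗ s j = LinearMap.id) (P : ∀ j, PartialResolution m (N j))
    {M : FGModuleCat.{v} R} (hP : ∀ j, (P j).Factors M) : (Q.toPartialResolution m).Factors M := by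
  change ∀ f : Q.X (m + 1) →ₗ[R] M, ∃ g : Q.X m →ₗ[R] M, g ∘ₗ Q.d m = f
  intro f
  have hs : ∀ j, ∃ φ : ∀ i, Q.X i →ₗ[R] (P j).X i, (P j).ε ∘ₗ φ 0 = s j ∘ₗ Q.ε ∧
      ∀ i ≤ m, (P j).d i ∘ₗ φ (i + 1) = φ i ∘ₗ Q.d i :=
    fun j => (Q.toPartialResolution m).exists_lift (P j) (s j)
  have hr : ∀ j, ∃ ψ : ∀ i, (P j).X i →ₗ[R] Q.X i, Q.ε ∘ₗ ψ 0 = r j ∘ₗ (P j).ε ∧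
      ∀ i ≤ m, Q.d i ∘ₗ ψ (i + 1) = ψ i ∘ₗ (P j).d i :=
    fun j => (P j).exists_lift (Q.toPartialResolution m) (r j)
  choose φ hφ0 hφ using hs
  choose ψ hψ0 hψ using hr
  -- This endomorphism lifts `∑ r j ∘ s j = id`, so minimality makes it bijective. Its inverse in
  -- degree `m + 1` corrects the factorizations obtained through the `P j`.
  let u : ∀ i, Q.X i →ₗ[R] Q.X i := fun i => ∑ j, ψ j i ∘ₗ φ j i
  have hu := Q.bijective_of_lift (m := m) u ?_ ?_ (m + 1) le_rfl
  · let e := LinearEquiv.ofBijective (u (m + 1)) hu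
    choose g hg using fun j => hP j (f ∘ₗ e.symm.toLinearMap ∘ₗ ψ j (m + 1))
    refine ⟨∑ j, g j ∘ₗ φ j m, LinearMap.ext fun x => ?_⟩
    have hx : ∀ j, g j (φ j m (Q.d m x)) = f (e.symm (ψ j (m + 1) (φ j (m + 1) x))) := by
      intro j
      exact (congrArg (g j) (LinearMap.congr_fun (hφ j m le_rfl) x).symm).trans
        (LinearMap.congr_fun (hg j) _)
    calc (∑ j, g j ∘ₗ φ j m) (Q.d m x) = ∑ j, g j (φ j m (Q.d m x)) := by simp
      _ = f (e.symm (∑ j, ψ j (m + 1) (φ j (m + 1) x))) := by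
        simp only [hx, map_sum]
      _ = f (e.symm (e x)) := by
        congr 2
        change _ = (∑ j, ψ j (m + 1) ∘ₗ φ j (m + 1)) x
        simp
      _ = f x := by rw [e.symm_apply_apply]
  · ext x
    have h1 : ∀ j, Q.ε (ψ j 0 (φ j 0 x)) = r j (s j (Q.ε x)) := fun j =>
      (LinearMap.congr_fun (hψ0 j) _).trans (congrArg (r j) (LinearMap.congr_fun (hφ0 j) x))
    have h2 := LinearMap.congr_fun hrs (Q.ε x)
    simp only [LinearMap.sum_apply, LinearMap.comp_apply, LinearMap.id_apply] at h2
    simp only [u, LinearMap.comp_apply, LinearMap.sum_apply, map_sum, h1, h2]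
  · intro i hi
    ext x
    have h1 : ∀ j, Q.d i (ψ j (i + 1) (φ j (i + 1) x)) = ψ j i (φ j i (Q.d i x)) := fun j =>
      (LinearMap.congr_fun (hψ j i hi) _).trans
        (congrArg (ψ j i) (LinearMap.congr_fun (hφ j i hi) x))
    simp only [u, LinearMap.comp_apply, LinearMap.sum_apply, map_sum, h1]

end MinimalProjectiveResolution

/-! ### Vanishing of `Hom(M, τ_n N)` through partial resolutions -/

section HigherTau

variable (k : Type w) [Field k] [Algebra k R] [Module.Finite k R]

theorem homZero_higherTau_iff (m : ℕ) (M N : FGModuleCat.{v} R) :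
    HomZero R M (higherTau k (m + 1) N) ↔
      ((minimalResolution k N).toPartialResolution m).Factors M := by
  have := (minimalResolution k N).projective
  exact Nakayama.homZero_ker_map_iff ((minimalResolution k N).d m) M

variable {k}

/-- Compare `P` with the minimal resolution along the identity. Only this implication is available:
the top term of `P` may contain a redundant summand killed by the differential, whose maps to `M` do
not factor. -/
theorem homZero_higherTau_of_factors {m : ℕ} {M N : FGModuleCat.{v} R} (P : PartialResolution m N)
    (hP : P.Factors M) : HomZero R M (higherTau k (m + 1) N) := by
  have : IsNoetherianRing R := IsNoetherianRing.of_finite k R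
  rw [homZero_higherTau_iff]
  exact (minimalResolution k N).factors_of_sum (ι := Unit) (fun _ => LinearMap.id)
    (fun _ => LinearMap.id) (by simp) (fun _ => P) fun _ => hP

/-- Replaces additivity of `τ_n` in its argument: comparing resolutions avoids making `τ_n` a
functor. -/
theorem homZero_higherTau_of_sum {m : ℕ} {M A : FGModuleCat.{v} R} {ι : Type*} [Fintype ι]
    {N : ι → FGModuleCat.{v} R} (s : ∀ j, A →ₗ[R] N j) (r : ∀ j, N j →ₗ[R] A)
    (hrs : ∑ j, r j ∘ₗ s j = LinearMap.id) (h : ∀ j, HomZero R M (higherTau k (m + 1) (N j))) :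
    HomZero R M (higherTau k (m + 1) A) := by
  have : IsNoetherianRing R := IsNoetherianRing.of_finite k R
  rw [homZero_higherTau_iff]
  exact (minimalResolution k A).factors_of_sum s r hrs _
    fun j => (homZero_higherTau_iff k m M (N j)).1 (h j)

theorem homZero_higherTau_of_retract {m : ℕ} {M A N : FGModuleCat.{v} R} (s : A →ₗ[R] N)
    (r : N →ₗ[R] A) (hrs : r ∘ₗ s = LinearMap.id) (h : HomZero R M (higherTau k (m + 1) N)) :
    HomZero R M (higherTau k (m + 1) A) :=
  homZero_higherTau_of_sum (ι := Unit) (fun _ => s) (fun _ => r) (by simpa using hrs) fun _ => h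

end HigherTau

/-! ### Vanishing of Hom on direct summands and direct sums -/

theorem HomZero.of_sum_left {A L : Type*} [AddCommGroup A] [Module R A] [AddCommGroup L]
    [Module R L] {ι : Type*} [Fintype ι] {N : ι → Type*} [∀ j, AddCommGroup (N j)]
    [∀ j, Module R (N j)] (s : ∀ j, A →ₗ[R] N j) (r : ∀ j, N j →ₗ[R] A)
    (hrs : ∑ j, r j ∘ₗ s j = LinearMap.id) (h : ∀ j, HomZero R (N j) L) : HomZero R A L := by
  intro f
  ext x
  rw [← LinearMap.id_apply (R := R) x, ← hrs, LinearMap.sum_apply, map_sum]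
  exact Finset.sum_eq_zero fun j _ => LinearMap.congr_fun (h j (f ∘ₗ r j)) (s j x)

theorem HomZero.of_retract_left {A N L : Type*} [AddCommGroup A] [Module R A] [AddCommGroup L]
    [Module R L] [AddCommGroup N] [Module R N] (s : A →ₗ[R] N) (r : N →ₗ[R] A)
    (hrs : r ∘ₗ s = LinearMap.id) (h : HomZero R N L) : HomZero R A L :=
  HomZero.of_sum_left (ι := Unit) (fun _ => s) (fun _ => r) (by simpa using hrs) fun _ => h

theorem HomZero.of_sum_right {A L : Type*} [AddCommGroup A] [Module R A] [AddCommGroup L]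
    [Module R L] {ι : Type*} [Fintype ι] {N : ι → Type*} [∀ j, AddCommGroup (N j)]
    [∀ j, Module R (N j)] (s : ∀ j, A →ₗ[R] N j) (r : ∀ j, N j →ₗ[R] A)
    (hrs : ∑ j, r j ∘ₗ s j = LinearMap.id) (h : ∀ j, HomZero R L (N j)) : HomZero R L A := by
  intro f
  ext x
  rw [← LinearMap.id_apply (R := R) (f x), ← hrs, LinearMap.sum_apply]
  exact Finset.sum_eq_zero fun j _ => by
    have := LinearMap.congr_fun (h j (s j ∘ₗ f)) x
    rw [LinearMap.comp_apply] at this ⊢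
    rw [this, LinearMap.zero_apply, map_zero]

theorem HomZero.of_retract_right {A N L : Type*} [AddCommGroup A] [Module R A] [AddCommGroup L]
    [Module R L] [AddCommGroup N] [Module R N] (s : A →ₗ[R] N) (r : N →ₗ[R] A)
    (hrs : r ∘ₗ s = LinearMap.id) (h : HomZero R L N) : HomZero R L A :=
  HomZero.of_sum_right (ι := Unit) (fun _ => s) (fun _ => r) (by simpa using hrs) fun _ => h

/-! ### Additive closures and rigid pairs -/

theorem modInAdd_of_sum {N M : FGModuleCat.{v} R} {ι : Type*} [Fintype ι] (s : ι → (N →ₗ[R] M))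
    (r : ι → (M →ₗ[R] N)) (hrs : ∑ j, r j ∘ₗ s j = LinearMap.id) : ModInAdd R N M := by
  let e := (Fintype.equivFin ι).symm
  refine ⟨Fintype.card ι, LinearMap.pi fun j => s (e j),
    ∑ j, r (e j) ∘ₗ LinearMap.proj j, ?_⟩
  rw [← hrs, ← e.sum_comp]
  ext x
  simp

theorem ModInAdd.exists_sum {N M : FGModuleCat.{v} R} (h : ModInAdd R N M) :
    ∃ (m : ℕ) (s : Fin m → (N →ₗ[R] M)) (r : Fin m → (M →ₗ[R] N)),
      ∑ j, r j ∘ₗ s j = LinearMap.id := by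
  obtain ⟨m, s, r, hrs⟩ := h
  refine ⟨m, fun j => LinearMap.proj j ∘ₗ s, fun j => r ∘ₗ LinearMap.single R (fun _ => M) j, ?_⟩
  ext x
  conv_rhs => rw [← hrs, LinearMap.comp_apply, ← LinearMap.sum_single_apply _ (s x), map_sum]
  simp

theorem ModInAdd.refl (M : FGModuleCat.{v} R) : ModInAdd R M M :=
  modInAdd_of_sum (ι := Unit) (fun _ => LinearMap.id) (fun _ => LinearMap.id) (by simp)

theorem modInAdd_of_sum_modInAdd {A M : FGModuleCat.{v} R} {ι : Type*} [Fintype ι]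
    {N : ι → FGModuleCat.{v} R} (s : ∀ j, A →ₗ[R] N j) (r : ∀ j, N j →ₗ[R] A)
    (hrs : ∑ j, r j ∘ₗ s j = LinearMap.id) (h : ∀ j, ModInAdd R (N j) M) : ModInAdd R A M := by
  choose m s' r' hrs' using fun j => (h j).exists_sum
  refine modInAdd_of_sum (ι := Σ j, Fin (m j)) (fun p => s' p.1 p.2 ∘ₗ s p.1)
    (fun p => r p.1 ∘ₗ r' p.1 p.2) ?_
  rw [Fintype.sum_sigma, ← hrs]
  refine Finset.sum_congr rfl fun j _ => ?_
  rw [← LinearMap.id_comp (s j), ← hrs' j]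
  ext x
  simp

variable {k : Type w} [Field k] [Algebra k R] [Module.Finite k R]

/-- Condition (i) for `N = M` gives rigidity of the pair. If `(M × N, P)` is rigid, restricting to
the summands `M` and `N` gives the three vanishing conditions on `N`. -/
theorem IsMaximalTauRigidPair.isSupportTauTiltingPair {m : ℕ}
    {𝒟 : ObjectProperty (FGModuleCat.{v} R)} {M P : FGModuleCat.{v} R}
    (h : IsMaximalTauRigidPair k (m + 1) 𝒟 M P) : IsSupportTauTiltingPair k (m + 1) 𝒟 M P := by
  obtain ⟨hM, hP, hN, hQ⟩ := h
  obtain ⟨h1, -, h2⟩ := (hN M hM).1 (ModInAdd.refl M)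
  refine ⟨⟨hM, hP, h1, h2⟩, fun N hDN ⟨_, _, h3, h4⟩ => (hN N hDN).2 ⟨?_, ?_, ?_⟩, hQ⟩
  · exact homZero_higherTau_of_retract (N := FGModuleCat.of R (M × N)) (LinearMap.inr R M N)
      (LinearMap.snd R M N) (by ext; rfl)
      (HomZero.of_retract_left (LinearMap.inl R M N) (LinearMap.fst R M N) (by ext; rfl) h3)
  · exact homZero_higherTau_of_retract (N := FGModuleCat.of R (M × N)) (LinearMap.inl R M N)
      (LinearMap.fst R M N) (by ext; rfl)
      (HomZero.of_retract_left (LinearMap.inr R M N) (LinearMap.snd R M N) (by ext; rfl) h3)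
  · exact HomZero.of_retract_right (LinearMap.inr R M N) (LinearMap.snd R M N) (by ext; rfl) h4

/-- `Hom(M × N, τ_n (M × N))` is controlled by four blocks: the two diagonal ones vanish by rigidity
of `M` and of `N`, the other two by `hMN` and `hNM`. -/
theorem IsTauRigidPair.prod {m : ℕ} {𝒟 : ObjectProperty (FGModuleCat.{v} R)}
    {M N P : FGModuleCat.{v} R} (h : IsTauRigidPair k (m + 1) 𝒟 M P)
    (hD : 𝒟 (FGModuleCat.of R (M × N))) (hN : IsTauRigid k (m + 1) N)
    (hMN : HomZero R M (higherTau k (m + 1) N)) (hNM : HomZero R N (higherTau k (m + 1) M))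
    (hPN : HomZero R P N) : IsTauRigidPair k (m + 1) 𝒟 (FGModuleCat.of R (M × N)) P := by
  obtain ⟨_, hP, hM, hPM⟩ := h
  let F : Bool → FGModuleCat.{v} R := fun b => cond b M N
  let s : ∀ b, FGModuleCat.of R (M × N) →ₗ[R] F b :=
    fun b => Bool.rec (LinearMap.snd R M N) (LinearMap.fst R M N) b
  let r : ∀ b, F b →ₗ[R] FGModuleCat.of R (M × N) :=
    fun b => Bool.rec (LinearMap.inr R M N) (LinearMap.inl R M N) b
  have hrs : ∑ b, r b ∘ₗ s b = LinearMap.id := by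
    rw [Fintype.sum_bool]
    refine LinearMap.ext fun x => ?_
    change ((x.1, 0) : M × N) + (0, x.2) = x
    simp
  refine ⟨hD, hP, ?_, HomZero.of_sum_right s r hrs (Bool.rec hPN hPM)⟩
  exact HomZero.of_sum_left s r hrs
    (Bool.rec (homZero_higherTau_of_sum s r hrs (Bool.rec hN hNM))
      (homZero_higherTau_of_sum s r hrs (Bool.rec hMN hM)))

/-- Support `τ_n`-tilting pairs are maximal `τ_n`-rigid pairs if `𝒟` is closed under direct sums
and every module in `𝒟` is a finite direct sum of `τ_n`-rigid modules in `𝒟`. -/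
theorem IsSupportTauTiltingPair.isMaximalTauRigidPair {m : ℕ}
    {𝒟 : ObjectProperty (FGModuleCat.{v} R)}
    (hprod : ∀ M N : FGModuleCat.{v} R, 𝒟 M → 𝒟 N → 𝒟 (FGModuleCat.of R (M × N)))
    (hdec : ∀ A : FGModuleCat.{v} R, 𝒟 A → ∃ (ι : Type) (_ : Fintype ι)
      (N : ι → FGModuleCat.{v} R) (s : ∀ j, A →ₗ[R] N j) (r : ∀ j, N j →ₗ[R] A),
      ∑ j, r j ∘ₗ s j = LinearMap.id ∧ ∀ j, s j ∘ₗ r j = LinearMap.id ∧ 𝒟 (N j) ∧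
        IsTauRigid k (m + 1) (N j))
    {M P : FGModuleCat.{v} R} (h : IsSupportTauTiltingPair k (m + 1) 𝒟 M P) :
    IsMaximalTauRigidPair k (m + 1) 𝒟 M P := by
  obtain ⟨hr, hN, hQ⟩ := h
  refine ⟨hr.1, hr.2.1, fun A hA => ⟨fun hAM => ?_, fun ⟨h1, h2, h3⟩ => ?_⟩, hQ⟩
  · obtain ⟨l, s, r, hrs⟩ := hAM.exists_sum
    exact ⟨homZero_higherTau_of_sum s r hrs fun _ => hr.2.2.1,
      HomZero.of_sum_left s r hrs fun _ => hr.2.2.1,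
      HomZero.of_sum_right s r hrs fun _ => hr.2.2.2⟩
  -- The summands are added to `M` one at a time, so only their own rigidity and their relations
  -- with `M` and `P` enter.
  · obtain ⟨ι, _, N, s, r, hrs, hN'⟩ := hdec A hA
    refine modInAdd_of_sum_modInAdd s r hrs fun j => ?_
    obtain ⟨hsr, hDN, hNr⟩ := hN' j
    exact hN _ hDN (hr.prod (hprod _ _ hr.1 hDN) hNr (homZero_higherTau_of_retract _ _ hsr h1)
      (HomZero.of_retract_left _ _ hsr h2) (HomZero.of_retract_right _ _ hsr h3))

end Modules

section Angulated

variable {C : Type u} [Category.{v} C]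

/-! ### Exact pairs of morphisms -/

section ExactPair

variable [Preadditive C]

/-- `A ⟶ B ⟶ D` is an exact pair if the first morphism is a weak kernel of the second one and
the second morphism is a weak cokernel of the first one. -/
structure ExactPair {A B D : C} (f : A ⟶ B) (g : B ⟶ D) : Prop where
  zero : f ≫ g = 0
  weakKernel : ∀ {W : C} (h : W ⟶ B), h ≫ g = 0 → ∃ l : W ⟶ A, l ≫ f = h
  weakCokernel : ∀ {W : C} (h : B ⟶ W), f ≫ h = 0 → ∃ l : D ⟶ W, g ≫ l = h

theorem ExactPair.of_iso {A B D A' B' D' : C} {f : A ⟶ B} {g : B ⟶ D} (h : ExactPair f g)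
    {f' : A' ⟶ B'} {g' : B' ⟶ D'} (a : A' ≅ A) (b : B' ≅ B) (d : D' ≅ D)
    (hf : f' ≫ b.hom = a.hom ≫ f) (hg : g' ≫ d.hom = b.hom ≫ g) : ExactPair f' g' := by
  have hf' : f' = a.hom ≫ f ≫ b.inv := by rw [← Category.assoc, ← hf]; simp
  have hg' : g' = b.hom ≫ g ≫ d.inv := by rw [← Category.assoc, ← hg]; simp
  subst hf' hg'
  refine ⟨by simp [reassoc_of% h.zero], fun k hk => ?_, fun k hk => ?_⟩
  · obtain ⟨l, hl⟩ := h.weakKernel (k ≫ b.hom) (by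
      rw [← cancel_mono d.inv]; simpa using hk)
    exact ⟨l ≫ a.inv, by simp [reassoc_of% hl]⟩
  · obtain ⟨l, hl⟩ := h.weakCokernel (b.inv ≫ k) (by
      rw [← cancel_epi a.hom]; simpa using hk)
    exact ⟨d.hom ≫ l, by simp [hl]⟩

theorem ExactPair.neg_right {A B D : C} {f : A ⟶ B} {g : B ⟶ D} (h : ExactPair f g) :
    ExactPair f (-g) := by
  refine ⟨by simp [h.zero], fun k hk => h.weakKernel k (by simpa using hk), fun k hk => ?_⟩
  obtain ⟨l, hl⟩ := h.weakCokernel k hk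
  exact ⟨-l, by simpa using hl⟩

end ExactPair

namespace SigmaSeq

variable {S : C ≌ C} {n : ℕ}

/-! ### Rotation and trivial sequences -/

section Rotate

variable [Preadditive C] (X : SigmaSeq S n)

/-- The terms of the left rotation. -/
def rotateObj (i : ℕ) (_ : i < n + 2) : C :=
  if h : i < n + 1 then X.obj (i + 1) (by omega) else S.functor.obj (X.obj 0 (by omega))

/-- The first `n + 1` terms of the left rotation. -/
def rotateObjIso (i : ℕ) (hi : i < n + 1) :
    X.rotateObj i (by omega) ≅ X.obj (i + 1) (by omega) :=
  eqToIso (dif_pos hi)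

/-- The last term of the left rotation. -/
def rotateObjIsoLast : X.rotateObj (n + 1) (by omega) ≅ S.functor.obj (X.obj 0 (by omega)) :=
  eqToIso (dif_neg (by omega))

/-- The left rotation of a sequence. -/
def rotate : SigmaSeq S n where
  obj := X.rotateObj
  map i hi :=
    if h : i < n then
      (X.rotateObjIso i hi).hom ≫ X.map (i + 1) (by omega) ≫
        (X.rotateObjIso (i + 1) (by omega)).inv
    else
      have hin : n = i := by omega
      hin ▸ ((X.rotateObjIso n (by omega)).hom ≫ X.last ≫ X.rotateObjIsoLast.inv)
  last := X.rotateObjIsoLast.hom ≫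
    ((-1 : ℤ) ^ (n + 2) • S.functor.map (X.map 0 (by omega))) ≫
      S.functor.map (X.rotateObjIso 0 (by omega)).inv

/-- The isomorphism `rotateObjIso` for the terms of `X.rotate`. -/
def rotateIso (i : ℕ) (hi : i < n + 1) : X.rotate.obj i (by omega) ≅ X.obj (i + 1) (by omega) :=
  X.rotateObjIso i hi

/-- The isomorphism `rotateObjIsoLast` for the last term of `X.rotate`. -/
def rotateIsoLast : X.rotate.obj (n + 1) (by omega) ≅ S.functor.obj (X.obj 0 (by omega)) :=
  X.rotateObjIsoLast

theorem rotate_map (i : ℕ) (hi : i < n) : X.rotate.map i (by omega) =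
    (X.rotateIso i (by omega)).hom ≫ X.map (i + 1) (by omega) ≫
      (X.rotateIso (i + 1) (by omega)).inv := dif_pos hi

theorem rotate_map_self : X.rotate.map n (by omega) =
    (X.rotateIso n (by omega)).hom ≫ X.last ≫ X.rotateIsoLast.inv := dif_neg (lt_irrefl n)

theorem rotate_last : X.rotate.last =
    X.rotateIsoLast.hom ≫ ((-1 : ℤ) ^ (n + 2) • S.functor.map (X.map 0 (by omega))) ≫
      S.functor.map (X.rotateIso 0 (by omega)).inv := rfl

theorem isLeftRotation_rotate : X.IsLeftRotation X.rotate := by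
  refine ⟨X.rotateIso, X.rotateIsoLast, fun i hi => ?_, ?_, ?_⟩
  · simp [rotate_map _ _ hi]
  · simp [rotate_map_self]
  · rw [rotate_last, Category.assoc, Category.assoc, ← Functor.map_comp, Iso.inv_hom_id,
      CategoryTheory.Functor.map_id, Category.comp_id]

end Rotate

section Trivial

variable [Preadditive C] [HasZeroObject C]

open ZeroObject

/-- The terms of the trivial sequence. -/
def trivialObj (A : C) : ℕ → C
  | 0 => A
  | 1 => A
  | _ + 2 => 0

/-- The maps of the trivial sequence. -/
def trivialMap (A : C) : ∀ i, trivialObj A i ⟶ trivialObj A (i + 1)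
  | 0 => 𝟙 A
  | _ + 1 => 0

variable (S n) in
/-- The trivial sequence `A ⟶ A ⟶ 0 ⟶ ⋯`. -/
def trivial (A : C) : SigmaSeq S n where
  obj i _ := trivialObj A i
  map i _ := trivialMap A i
  last := 0

/-- The first term of the trivial sequence. -/
def trivialIsoZero (A : C) : (trivial S n A).obj 0 (by omega) ≅ A := Iso.refl _

/-- The second term of the trivial sequence. -/
def trivialIsoOne (A : C) : (trivial S n A).obj (0 + 1) (by omega) ≅ A := Iso.refl _

theorem trivial_map_zero (A : C) : (trivial S n A).map 0 (by omega) =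
    (trivialIsoZero A).hom ≫ (trivialIsoOne A).inv := (Category.comp_id (𝟙 A)).symm

theorem trivial_map_succ (A : C) (i : ℕ) (hi : i + 1 < n + 1) :
    (trivial S n A).map (i + 1) hi = 0 := rfl

theorem isTrivial_trivial (A : C) : (trivial S n A).IsTrivial := by
  refine ⟨by rw [trivial_map_zero]; infer_instance, fun i _ h => ?_⟩
  obtain ⟨j, rfl⟩ := Nat.exists_eq_add_of_le' h
  exact isZero_zero C

/-- The terms of the right rotation of the trivial sequence. -/
def cotrivialObj (A : C) : ℕ → C
  | 0 => 0
  | i + 1 => trivialObj A i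

/-- The maps of the right rotation of the trivial sequence. -/
def cotrivialMap (A : C) : ∀ i, cotrivialObj A i ⟶ cotrivialObj A (i + 1)
  | 0 => 0
  | i + 1 => trivialMap A i

variable (S n) in
/-- The sequence `0 ⟶ A ⟶ A ⟶ 0 ⟶ ⋯`. -/
def cotrivial (A : C) : SigmaSeq S n where
  obj i _ := cotrivialObj A i
  map i _ := cotrivialMap A i
  last := 0

/-- The second term of the right rotation of the trivial sequence. -/
def cotrivialIsoOne (A : C) : (cotrivial S n A).obj (0 + 1) (by omega) ≅ A := Iso.refl _

/-- The third term of the right rotation of the trivial sequence. -/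
def cotrivialIsoTwo (hn : 1 ≤ n) (A : C) :
    (cotrivial S n A).obj (0 + 1 + 1) (by omega) ≅ A := Iso.refl _

theorem cotrivial_map_one (hn : 1 ≤ n) (A : C) : (cotrivial S n A).map (0 + 1) (by omega) =
    (cotrivialIsoOne A).hom ≫ (cotrivialIsoTwo hn A).inv := (Category.comp_id (𝟙 A)).symm

theorem isTrivial_rotate_cotrivial (hn : 1 ≤ n) (A : C) :
    (cotrivial S n A).rotate.IsTrivial := by
  refine ⟨?_, fun i hi h => ?_⟩
  · rw [rotate_map _ _ (by omega), cotrivial_map_one hn]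
    infer_instance
  · by_cases hi' : i < n + 1
    · refine IsZero.of_iso ?_ ((cotrivial S n A).rotateIso i hi')
      obtain ⟨j, rfl⟩ := Nat.exists_eq_add_of_le' h
      exact isZero_zero C
    · obtain rfl : i = n + 1 := by omega
      refine IsZero.of_iso ?_ ((cotrivial S n A).rotateIsoLast)
      exact S.functor.map_isZero (isZero_zero C)

end Trivial

end SigmaSeq

/-! ### Exactness of angles -/

namespace Angulation

variable [Preadditive C] [HasFiniteBiproducts C]

instance hasZeroObject_of_finiteBiproducts : HasZeroObject C := hasZeroObject_of_hasFiniteBiproducts C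

variable {n : ℕ} (𝒜 : Angulation C n)

instance additive_functor : 𝒜.S.functor.Additive :=
  have := preservesBinaryBiproducts_of_preservesBinaryProducts 𝒜.S.functor
  Functor.additive_of_preservesBinaryBiproducts _

theorem rotate_mem {X : SigmaSeq 𝒜.S n} (hX : X ∈ 𝒜.angles) : X.rotate ∈ 𝒜.angles :=
  (𝒜.rotate_iff _ _ X.isLeftRotation_rotate).1 hX

/-- Its left rotation is trivial, and (F2) can be read backwards. This angle is the target that
detects weak cokernels. -/
theorem cotrivial_mem (hn : 1 ≤ n) (A : C) : SigmaSeq.cotrivial 𝒜.S n A ∈ 𝒜.angles :=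
  (𝒜.rotate_iff _ _ (SigmaSeq.isLeftRotation_rotate _)).2
    (𝒜.trivial_mem _ (SigmaSeq.isTrivial_rotate_cotrivial hn A))

/-- Each clause comes from (F3) applied to a comparison with a trivial angle or one of its
rotations: `A ⟶ A ⟶ 0 ⟶ ⋯` mapped to `X` for the zero composite, a rotated trivial angle mapped to
the rotation of `X` for the weak kernel, and `X` mapped to `0 ⟶ W ⟶ W ⟶ ⋯` for the weak cokernel. -/
theorem exactPair_zero (hn : 1 ≤ n) {X : SigmaSeq 𝒜.S n} (hX : X ∈ 𝒜.angles) :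
    ExactPair (X.map 0 (by omega)) (X.map (0 + 1) (by omega)) := by
  refine ⟨?_, fun {W} h hh => ?_, fun {W} h hh => ?_⟩
  · set A := X.obj 0 (by omega)
    obtain ⟨φ, h0, h1, -⟩ := 𝒜.exists_hom _
      (𝒜.trivial_mem _ (SigmaSeq.isTrivial_trivial A)) X hX
      (SigmaSeq.trivialIsoZero A).hom ((SigmaSeq.trivialIsoOne A).hom ≫ X.map 0 (by omega)) (by
        simp [SigmaSeq.trivial_map_zero, A])
    have := φ.comm (0 + 1) (by omega)
    rw [h1, SigmaSeq.trivial_map_succ, zero_comp, Category.assoc] at this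
    rw [← cancel_epi (SigmaSeq.trivialIsoOne A).hom, comp_zero]
    exact this.symm
  · set Y := SigmaSeq.trivial 𝒜.S n W with hY
    have hW : Y.rotate ∈ 𝒜.angles :=
      𝒜.rotate_mem (𝒜.trivial_mem _ (SigmaSeq.isTrivial_trivial W))
    let e₀ : Y.obj 0 (by omega) ≅ W := SigmaSeq.trivialIsoZero W
    let e₁ : Y.obj (0 + 1) (by omega) ≅ W := SigmaSeq.trivialIsoOne W
    have hY0 : Y.map 0 (by omega) = e₀.hom ≫ e₁.inv := SigmaSeq.trivial_map_zero W
    obtain ⟨φ, h0, -⟩ := 𝒜.exists_hom _ hW _ (𝒜.rotate_mem hX)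
      ((Y.rotateIso 0 (by omega)).hom ≫ e₁.hom ≫ h ≫ (X.rotateIso 0 (by omega)).inv) 0 (by
        rw [comp_zero, SigmaSeq.rotate_map _ _ (by omega)]
        simp only [Category.assoc, Iso.inv_hom_id_assoc]
        rw [reassoc_of% hh]
        simp)
    have hl := φ.comm_last
    rw [h0, SigmaSeq.rotate_last, SigmaSeq.rotate_last, hY0] at hl
    -- The final square of the morphism of angles factors `Σ h` through `Σ α_0`. Both rotations
    -- carry the same sign, which cancels; as `Σ` is fully faithful, the factorization descends to
    -- `h`.
    obtain ⟨p, hp⟩ : ∃ p, p ≫ 𝒜.S.functor.map (X.map 0 (by omega)) = 𝒜.S.functor.map h := by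
      rcases neg_one_pow_eq_or ℤ (n + 2) with hs | hs <;> rw [hs] at hl
      all_goals
        refine ⟨𝒜.S.functor.map e₀.inv ≫ Y.rotateIsoLast.inv ≫ φ.app (n + 1) (by omega) ≫
          X.rotateIsoLast.hom, ?_⟩
        rw [← cancel_mono (𝒜.S.functor.map (X.rotateIso 0 (by omega)).inv),
          ← cancel_epi (Y.rotateIsoLast.hom ≫ 𝒜.S.functor.map e₀.hom)]
        simpa [← Functor.map_comp_assoc, ← Functor.map_comp] using hl.symm
    refine ⟨𝒜.S.functor.preimage p, 𝒜.S.functor.map_injective ?_⟩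
    rw [Functor.map_comp, Functor.map_preimage, hp]
  · obtain ⟨φ, -, h1, -⟩ := 𝒜.exists_hom X hX _ (𝒜.cotrivial_mem hn W) 0
      (h ≫ (SigmaSeq.cotrivialIsoOne W).inv) (by rw [reassoc_of% hh, zero_comp, zero_comp])
    refine ⟨φ.app (0 + 1 + 1) (by omega) ≫ (SigmaSeq.cotrivialIsoTwo hn W).hom, ?_⟩
    rw [← Category.assoc, φ.comm (0 + 1) (by omega), h1, SigmaSeq.cotrivial_map_one hn]
    simp

theorem exactPair_map (i : ℕ) (hi : i + 1 < n + 1) :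
    ∀ {X : SigmaSeq 𝒜.S n}, X ∈ 𝒜.angles →
      ExactPair (X.map i (by omega)) (X.map (i + 1) hi) := by
  induction i with
  | zero => exact fun hX => 𝒜.exactPair_zero (by omega) hX
  | succ i ih =>
    intro X hX
    refine (ih (by omega) (𝒜.rotate_mem hX)).of_iso (X.rotateIso i (by omega)).symm
      (X.rotateIso (i + 1) (by omega)).symm (X.rotateIso (i + 1 + 1) (by omega)).symm ?_ ?_
    · rw [SigmaSeq.rotate_map _ _ (by omega)]
      simp
    · rw [SigmaSeq.rotate_map _ _ (by omega)]
      simp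

theorem exactPair_last {m : ℕ} (𝒜 : Angulation C (m + 1)) {X : SigmaSeq 𝒜.S (m + 1)}
    (hX : X ∈ 𝒜.angles) : ExactPair (X.map (m + 1) (by omega)) X.last := by
  refine (𝒜.exactPair_map m (by omega) (𝒜.rotate_mem hX)).of_iso (X.rotateIso m (by omega)).symm
    (X.rotateIso (m + 1) (by omega)).symm X.rotateIsoLast.symm ?_ ?_
  · rw [SigmaSeq.rotate_map _ _ (by omega)]
    simp
  · rw [SigmaSeq.rotate_map_self]
    simp

/-- The last exact pair of the rotated angle; the rotation sign does not affect exactness. -/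
theorem exactPair_functor {m : ℕ} (𝒜 : Angulation C (m + 1)) {X : SigmaSeq 𝒜.S (m + 1)}
    (hX : X ∈ 𝒜.angles) : ExactPair X.last (𝒜.S.functor.map (X.map 0 (by omega))) := by
  have h : ExactPair X.last
      ((-1 : ℤ) ^ (m + 1 + 2) • 𝒜.S.functor.map (X.map 0 (by omega))) := by
    refine (𝒜.exactPair_last (𝒜.rotate_mem hX)).of_iso (X.rotateIso (m + 1) (by omega)).symm
      X.rotateIsoLast.symm (𝒜.S.functor.mapIso (X.rotateIso 0 (by omega)).symm) ?_ ?_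
    · rw [SigmaSeq.rotate_map_self]
      simp
    · rw [SigmaSeq.rotate_last]
      simp
  rcases neg_one_pow_eq_or ℤ (m + 1 + 2) with hs | hs
  · rwa [hs, one_smul] at h
  · rw [hs, neg_one_smul] at h
    simpa using h.neg_right

/-- If `X_{n+1}` has no nonzero maps to `Σ Y`, then all maps `X_0 ⟶ Y` factor through
`X_0 ⟶ X_1`. -/
theorem exists_map_zero_comp_eq {m : ℕ} (𝒜 : Angulation C (m + 1)) {X : SigmaSeq 𝒜.S (m + 1)}
    (hX : X ∈ 𝒜.angles) {Y : C}
    (hY : ∀ g : X.obj (m + 1 + 1) (by omega) ⟶ 𝒜.S.functor.obj Y, g = 0)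
    (f : X.obj 0 (by omega) ⟶ Y) :
    ∃ g : X.obj (0 + 1) (by omega) ⟶ Y, X.map 0 (by omega) ≫ g = f := by
  obtain ⟨p, hp⟩ := (𝒜.exactPair_functor hX).weakCokernel (𝒜.S.functor.map f) (hY _)
  refine ⟨𝒜.S.functor.preimage p, 𝒜.S.functor.map_injective ?_⟩
  rw [Functor.map_comp, Functor.map_preimage, hp]

end Angulation

end Angulated

/-! ### Decomposition into indecomposable objects -/

section Decomposition

variable {C : Type u} [Category.{v} C] [Preadditive C] [HasFiniteBiproducts C]

theorem InAdd.exists_sum {X M : C} (h : InAdd X M) :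
    ∃ (m : ℕ) (s : Fin m → (X ⟶ M)) (r : Fin m → (M ⟶ X)), ∑ j, s j ≫ r j = 𝟙 X := by
  obtain ⟨m, ⟨ρ⟩⟩ := h
  refine ⟨m, fun j => ρ.i ≫ biproduct.π (fun _ => M) j,
    fun j => biproduct.ι (fun _ => M) j ≫ ρ.r, ?_⟩
  have := congrArg (fun t => ρ.i ≫ t ≫ ρ.r) (biproduct.total (f := fun _ : Fin m => M))
  simp only [Preadditive.comp_sum, Preadditive.sum_comp, Category.id_comp, ρ.retract] at this
  simpa only [Category.assoc] using this

-- `f ↦ r ≫ f ≫ s` embeds `End Y` in `End X`. If it hit `𝟙 X`, then `s' ≫ r = 0` would force `s' =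
-- 0`, hence `Z = 0`. This gives the induction measure for decompositions.
omit [HasFiniteBiproducts C] in
theorem finrank_end_lt (k : Type w) [Field k] [Linear k C] {X Y Z : C}
    [Module.Finite k (X ⟶ X)] (s : Y ⟶ X) (r : X ⟶ Y) (hrs : s ≫ r = 𝟙 Y) (s' : Z ⟶ X)
    (r' : X ⟶ Z) (hrs' : s' ≫ r' = 𝟙 Z) (h : s' ≫ r = 0) (hZ : ¬IsZero Z) :
    Module.finrank k (Y ⟶ Y) < Module.finrank k (X ⟶ X) := by
  let L : (Y ⟶ Y) →ₗ[k] (X ⟶ X) :=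
    { toFun := fun f => r ≫ f ≫ s
      map_add' := by simp
      map_smul' := by simp }
  have hL : Function.Injective L := fun f g hfg => by
    have : s ≫ (r ≫ f ≫ s) ≫ r = s ≫ (r ≫ g ≫ s) ≫ r := by
      rw [show r ≫ f ≫ s = r ≫ g ≫ s from hfg]
    simpa [hrs, reassoc_of% hrs] using this
  rw [← LinearMap.finrank_range_of_inj hL]
  refine Submodule.finrank_lt fun htop => hZ ?_
  obtain ⟨f, hf⟩ := LinearMap.range_eq_top.1 htop (𝟙 X)
  have hf' : r ≫ f ≫ s = 𝟙 X := hf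
  rw [IsZero.iff_id_eq_zero, ← hrs', ← Category.id_comp r', ← hf']
  simp [reassoc_of% h]

/-- In a Hom-finite category every object is a finite direct sum of indecomposable objects. -/
theorem exists_indecomposable_decomposition (k : Type w) [Field k] [Linear k C]
    [∀ X Y : C, Module.Finite k (X ⟶ Y)] (X : C) :
    ∃ (ι : Type) (_ : Fintype ι) (N : ι → C) (s : ∀ j, X ⟶ N j) (r : ∀ j, N j ⟶ X),
      ∑ j, s j ≫ r j = 𝟙 X ∧ ∀ j, r j ≫ s j = 𝟙 (N j) ∧ Indecomposable (N j) := by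
  induction hd : Module.finrank k (X ⟶ X) using Nat.strong_induction_on generalizing X with
  | _ d ih =>
  subst hd
  by_cases h0 : IsZero X
  · exact ⟨Empty, inferInstance, Empty.elim, fun j => j.elim, fun j => j.elim,
      h0.eq_of_src _ _, fun j => j.elim⟩
  by_cases hX : Indecomposable X
  · exact ⟨Unit, inferInstance, fun _ => X, fun _ => 𝟙 X, fun _ => 𝟙 X, by simp, by simp [hX]⟩
  obtain ⟨Y, Z, e, hY, hZ⟩ : ∃ (Y Z : C) (_ : X ≅ Y ⊞ Z), ¬IsZero Y ∧ ¬IsZero Z := by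
    by_contra! hc
    exact hX ⟨h0, fun Y Z e => or_iff_not_imp_left.2 (hc Y Z e)⟩
  obtain ⟨ι₁, _, N₁, s₁, r₁, h₁, h₁'⟩ := ih _ (finrank_end_lt k (X := X) (Y := Y) (Z := Z)
    (biprod.inl ≫ e.inv) (e.hom ≫ biprod.fst) (by simp) (biprod.inr ≫ e.inv)
    (e.hom ≫ biprod.snd) (by simp) (by simp) hZ) Y rfl
  obtain ⟨ι₂, _, N₂, s₂, r₂, h₂, h₂'⟩ := ih _ (finrank_end_lt k (X := X) (Y := Z) (Z := Y)
    (biprod.inr ≫ e.inv) (e.hom ≫ biprod.snd) (by simp) (biprod.inl ≫ e.inv)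
    (e.hom ≫ biprod.fst) (by simp) (by simp) hY) Z rfl
  refine ⟨ι₁ ⊕ ι₂, inferInstance, Sum.elim N₁ N₂,
    fun j => Sum.rec (fun j => e.hom ≫ biprod.fst ≫ s₁ j) (fun j => e.hom ≫ biprod.snd ≫ s₂ j) j,
    fun j => Sum.rec (fun j => r₁ j ≫ biprod.inl ≫ e.inv) (fun j => r₂ j ≫ biprod.inr ≫ e.inv) j,
    ?_, ?_⟩
  · have e₁ : ∑ j, (e.hom ≫ biprod.fst ≫ s₁ j) ≫ r₁ j ≫ biprod.inl ≫ e.inv =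
        e.hom ≫ (biprod.fst ≫ biprod.inl) ≫ e.inv := by
      simpa [Preadditive.comp_sum, Preadditive.sum_comp] using
        congrArg (fun t => e.hom ≫ (biprod.fst ≫ t ≫ biprod.inl) ≫ e.inv) h₁
    have e₂ : ∑ j, (e.hom ≫ biprod.snd ≫ s₂ j) ≫ r₂ j ≫ biprod.inr ≫ e.inv =
        e.hom ≫ (biprod.snd ≫ biprod.inr) ≫ e.inv := by
      simpa [Preadditive.comp_sum, Preadditive.sum_comp] using
        congrArg (fun t => e.hom ≫ (biprod.snd ≫ t ≫ biprod.inr) ≫ e.inv) h₂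
    rw [Fintype.sum_sum_type]
    refine (congrArg₂ (· + ·) e₁ e₂).trans ?_
    rw [← Preadditive.comp_add, ← Preadditive.add_comp, biprod.total]
    simp
  · rintro (j | j)
    · exact ⟨by simpa using (h₁' j).1, (h₁' j).2⟩
    · exact ⟨by simpa using (h₂' j).1, (h₂' j).2⟩

end Decomposition

/-! ### The functor `C(T, -)` on morphisms and on `add T` -/

section HomFunctor

variable (k : Type w) [Field k] {C : Type u} [Category.{v} C] [Preadditive C] [Linear k C]
  [∀ X Y : C, Module.Finite k (X ⟶ Y)] (T : C)

/-- The linear map `C(T, f)`. -/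
def homMap {X Y : C} (f : X ⟶ Y) :
    (homFunctor k T).obj X →ₗ[(End T)ᵐᵒᵖ] (homFunctor k T).obj Y :=
  ((homFunctor k T).map f).hom.hom

variable {T}

theorem homMap_comp {X Y Z : C} (f : X ⟶ Y) (g : Y ⟶ Z) :
    homMap k T g ∘ₗ homMap k T f = homMap k T (f ≫ g) :=
  LinearMap.ext fun _ => Category.assoc _ _ _

theorem homMap_id (X : C) : homMap k T (𝟙 X) = LinearMap.id :=
  LinearMap.ext fun _ => Category.comp_id _

theorem homMap_sum {X Y : C} {ι : Type*} (s : Finset ι) (f : ι → (X ⟶ Y)) :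
    homMap k T (∑ j ∈ s, f j) = ∑ j ∈ s, homMap k T (f j) := by
  refine LinearMap.ext fun g => ?_
  rw [LinearMap.sum_apply]
  exact Preadditive.comp_sum (P := T) s g f

theorem homMap_sum_comp {X : C} {ι : Type*} [Fintype ι] {N : ι → C} (s : ∀ j, X ⟶ N j)
    (r : ∀ j, N j ⟶ X) (h : ∑ j, s j ≫ r j = 𝟙 X) :
    ∑ j, homMap k T (r j) ∘ₗ homMap k T (s j) = LinearMap.id := by
  simp only [homMap_comp]
  rw [← homMap_sum, h, homMap_id]

theorem exact_homMap {A B D : C} {f : A ⟶ B} {g : B ⟶ D} (h : ExactPair f g) :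
    Function.Exact (homMap k T f) (homMap k T g) := by
  intro x
  refine ⟨fun hx => h.weakKernel (W := T) x hx, ?_⟩
  rintro ⟨y, rfl⟩
  refine (Category.assoc (W := T) y f g).trans ?_
  rw [h.zero]
  exact comp_zero (X := T)

/-- The module `C(T, T)` is free of rank one. -/
def homFunctorSelfEquiv : (homFunctor k T).obj T ≃ₗ[(End T)ᵐᵒᵖ] (End T)ᵐᵒᵖ where
  toFun t := MulOpposite.op (show End T from t)
  invFun t := (t.unop : T ⟶ T)
  map_add' _ _ := rfl
  map_smul' _ _ := rfl
  left_inv _ := rfl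
  right_inv _ := rfl

/-- The Yoneda lemma for `C(T, T)`. -/
theorem homMap_map_id {Y : C} (g : (homFunctor k T).obj T →ₗ[(End T)ᵐᵒᵖ] (homFunctor k T).obj Y) :
    homMap k T (show T ⟶ Y from g (𝟙 T)) = g := by
  refine LinearMap.ext fun (t : T ⟶ T) => ?_
  refine Eq.trans ?_ (congrArg g (Category.comp_id t))
  exact (g.map_smul (MulOpposite.op (show End T from t)) (𝟙 T)).symm

variable [HasFiniteBiproducts C]

/-- Yoneda settles `X = T`; the general case follows by writing `𝟙 X` as a sum of maps through `T`.
-/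
theorem exists_homMap_eq {X Y : C} (hX : InAdd X T)
    (g : (homFunctor k T).obj X →ₗ[(End T)ᵐᵒᵖ] (homFunctor k T).obj Y) :
    ∃ f : X ⟶ Y, homMap k T f = g := by
  obtain ⟨m, s, r, h⟩ := hX.exists_sum
  refine ⟨∑ j, s j ≫ (show T ⟶ Y from (g ∘ₗ homMap k T (r j)) (𝟙 T)), ?_⟩
  have hj : ∀ j, homMap k T (s j ≫ (show T ⟶ Y from (g ∘ₗ homMap k T (r j)) (𝟙 T))) =
      (g ∘ₗ homMap k T (r j)) ∘ₗ homMap k T (s j) := fun j =>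
    (homMap_comp k _ _).symm.trans
      (congrArg (fun t => t ∘ₗ homMap k T (s j)) (homMap_map_id k (g ∘ₗ homMap k T (r j))))
  refine (homMap_sum k _ _).trans ((Finset.sum_congr rfl fun j _ => hj j).trans ?_)
  refine LinearMap.ext fun y => ?_
  conv_rhs => rw [← LinearMap.id_apply (R := (End T)ᵐᵒᵖ) y, ← homMap_sum_comp k s r h]
  simp only [LinearMap.sum_apply, LinearMap.comp_apply, map_sum]

theorem projective_homFunctor {X : C} (hX : InAdd X T) :
    Module.Projective (End T)ᵐᵒᵖ ((homFunctor k T).obj X) := by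
  obtain ⟨m, s, r, h⟩ := hX.exists_sum
  have := Module.Projective.of_equiv (homFunctorSelfEquiv k (T := T)).symm
  have : Module.Projective (End T)ᵐᵒᵖ (Fin m → (homFunctor k T).obj T) :=
    Module.Projective.of_equiv
      (DFinsupp.linearEquivFunOnFintype (M := fun _ : Fin m => (homFunctor k T).obj T))
  refine Module.Projective.of_split (LinearMap.pi fun j => homMap k T (s j))
    (∑ j, homMap k T (r j) ∘ₗ LinearMap.proj j) ?_
  rw [← homMap_sum_comp k s r h]
  ext x
  simp

/-- The modules of the form `C(T, X)` are closed under direct sums. -/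
theorem essImage_prod {M N : FGModuleCat.{v} (End T)ᵐᵒᵖ} (hM : (homFunctor k T).essImage M)
    (hN : (homFunctor k T).essImage N) :
    (homFunctor k T).essImage (FGModuleCat.of (End T)ᵐᵒᵖ (M × N)) := by
  obtain ⟨X, ⟨e⟩⟩ := hM
  obtain ⟨Y, ⟨e'⟩⟩ := hN
  have h₁ : ∀ (a : T ⟶ X) (b : T ⟶ Y), (a ≫ biprod.inl + b ≫ biprod.inr) ≫ biprod.fst = a := by
    simp
  have h₂ : ∀ (a : T ⟶ X) (b : T ⟶ Y), (a ≫ biprod.inl + b ≫ biprod.inr) ≫ biprod.snd = b := by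
    simp
  have h₃ : ∀ c : T ⟶ X ⊞ Y,
      (c ≫ biprod.fst) ≫ biprod.inl + (c ≫ biprod.snd) ≫ biprod.inr = c := fun c => by
    rw [Category.assoc, Category.assoc, ← Preadditive.comp_add, biprod.total, Category.comp_id]
  let E : (homFunctor k T).obj (X ⊞ Y) ≃ₗ[(End T)ᵐᵒᵖ]
      (homFunctor k T).obj X × (homFunctor k T).obj Y :=
    LinearEquiv.ofLinearMap
      (LinearMap.prod (homMap k T biprod.fst) (homMap k T biprod.snd))
      (LinearMap.coprod (homMap k T biprod.inl) (homMap k T biprod.inr))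
      (LinearMap.ext fun x => Prod.ext (h₁ x.1 x.2) (h₂ x.1 x.2)) (LinearMap.ext fun x => h₃ x)
  exact ⟨X ⊞ Y, ⟨(E.trans ((FGModuleCat.isoToLinearEquiv e).prodCongr
    (FGModuleCat.isoToLinearEquiv e'))).toFGModuleCatIso⟩⟩

end HomFunctor

/-! ### Resolutions from angles -/

section Resolution

namespace SigmaSeq

variable {C : Type u} [Category.{v} C] {S : C ≌ C} {n : ℕ}

/-- The map `X_a ⟶ X_b` of a sequence if `b = a + 1`, and zero otherwise. -/
def mapOfEq [HasZeroMorphisms C] (X : SigmaSeq S n) (a b : ℕ) (ha : a < n + 2) (hb : b < n + 2) :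
    X.obj a ha ⟶ X.obj b hb :=
  if h : a + 1 = b then X.map a (by omega) ≫ eqToHom (by subst h; rfl) else 0

theorem mapOfEq_succ [HasZeroMorphisms C] (X : SigmaSeq S n) (a : ℕ) (ha : a < n + 1) :
    X.mapOfEq a (a + 1) (by omega) (by omega) = X.map a ha := by
  simp [mapOfEq]

end SigmaSeq

namespace Angulation

variable (k : Type w) [Field k] {C : Type u} [Category.{v} C] [Preadditive C] [Linear k C]
  [∀ X Y : C, Module.Finite k (X ⟶ Y)] {T : C} [HasFiniteBiproducts C] {m : ℕ}
  (𝒜 : Angulation C (m + 1))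

/-- Indices enter through equations because a resolution reads the angle backwards: `m + 1 - (i + 1)
+ 1` and `m + 1 - i` agree only propositionally, and only for `i ≤ m`. -/
theorem exactPair_mapOfEq {X : SigmaSeq 𝒜.S (m + 1)} (hX : X ∈ 𝒜.angles) {a b c : ℕ}
    (hab : a + 1 = b) (hbc : b + 1 = c) (hc : c < m + 1 + 2) :
    ExactPair (X.mapOfEq a b (by omega) (by omega)) (X.mapOfEq b c (by omega) hc) := by
  subst hab hbc
  rw [X.mapOfEq_succ _ (by omega), X.mapOfEq_succ _ (by omega)]
  exact 𝒜.exactPair_map a (by omega) hX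

theorem factors_mapOfEq {X : SigmaSeq 𝒜.S (m + 1)} (hX : X ∈ 𝒜.angles) {a b : ℕ} (ha : a = 0)
    (hb : b = 1) (hT : ∀ (i : ℕ) (hi : i ≤ m + 1), InAdd (X.obj i (by omega)) T) {Y : C}
    (hY : ∀ g : X.obj (m + 1 + 1) (by omega) ⟶ 𝒜.S.functor.obj Y, g = 0)
    (f : (homFunctor k T).obj (X.obj a (by omega)) →ₗ[(End T)ᵐᵒᵖ] (homFunctor k T).obj Y) :
    ∃ g : (homFunctor k T).obj (X.obj b (by omega)) →ₗ[(End T)ᵐᵒᵖ] (homFunctor k T).obj Y,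
      g ∘ₗ homMap k T (X.mapOfEq a b (by omega) (by omega)) = f := by
  subst ha hb
  obtain ⟨f, rfl⟩ := exists_homMap_eq k (hT 0 (by omega)) f
  obtain ⟨g, rfl⟩ := 𝒜.exists_map_zero_comp_eq hX hY f
  refine ⟨homMap k T g, ?_⟩
  rw [homMap_comp, X.mapOfEq_succ 0 (by omega)]

variable {𝒜} in
theorem IsRigid.of_inAdd {X : C} (hT : 𝒜.IsRigid T) (hX : InAdd X T)
    (f : T ⟶ 𝒜.S.functor.obj X) : f = 0 := by
  obtain ⟨l, s, r, h⟩ := hX.exists_sum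
  rw [← Category.comp_id f, ← CategoryTheory.Functor.map_id, ← h, Functor.map_sum,
    Preadditive.comp_sum]
  refine Finset.sum_eq_zero fun j _ => ?_
  rw [Functor.map_comp, ← Category.assoc, hT (f ≫ _), zero_comp]

/-- An angle `T_0 ⟶ ⋯ ⟶ T_n ⟶ X ⟶ Σ T_0` with `T_i ∈ add T` gives rise to a partial projective
resolution of `C(T, X)`. -/
def resolution (hT : 𝒜.IsRigid T) {Z : SigmaSeq 𝒜.S (m + 1)} (hZ : Z ∈ 𝒜.angles)
    (h : ∀ (i : ℕ) (hi : i ≤ m + 1), InAdd (Z.obj i (by omega)) T) :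
    PartialResolution m ((homFunctor k T).obj (Z.obj (m + 1 + 1) (by omega))) where
  -- With `n = m + 1`, degree `i` holds `T_{n-i}`, so degree `n` holds `T_0`. Beyond that, truncated
  -- subtraction repeats `T_0` and `mapOfEq` is zero; exactness is not claimed there.
  X i := (homFunctor k T).obj (Z.obj (m + 1 - i) (by omega))
  d i := homMap k T (Z.mapOfEq (m + 1 - (i + 1)) (m + 1 - i) (by omega) (by omega))
  ε := homMap k T (Z.map (m + 1) (by omega))
  projective i := projective_homFunctor k (h _ (by omega))
  exact i hi := exact_homMap k (𝒜.exactPair_mapOfEq hZ (by omega) (by omega) (by omega))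
  exact_zero := by
    have := exact_homMap k (T := T) (𝒜.exactPair_mapOfEq hZ (a := m) (b := m + 1) rfl rfl
      (by omega))
    rwa [Z.mapOfEq_succ (m + 1) (by omega)] at this
  -- A map `T ⟶ X` lifts to `T_n` because its composite to `Σ T_0` vanishes, `T` being rigid and
  -- `T_0 ∈ add T`.
  surjective x := (𝒜.exactPair_last hZ).weakKernel (W := T) x (hT.of_inAdd (h 0 (by omega)) _)

/-- If `X` is `n`-rigid, then `C(T, X)` is `τ_n`-rigid. -/
theorem IsClusterTilting.isTauRigid (hT : 𝒜.IsClusterTilting T) {X : C} (hX : 𝒜.IsRigid X) :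
    IsTauRigid k (m + 1) ((homFunctor k T).obj X) := by
  obtain ⟨hT, h⟩ := hT
  obtain ⟨Z, hZ, hZT, ⟨e⟩⟩ := h X
  refine homZero_higherTau_of_retract (homMap k T e.inv) (homMap k T e.hom)
    (by rw [homMap_comp, e.inv_hom_id, homMap_id])
    (homZero_higherTau_of_factors (𝒜.resolution k hT hZ hZT) fun f => ?_)
  refine 𝒜.factors_mapOfEq k hZ (by omega) (by omega) hZT (fun g => ?_) f
  -- Rigidity of `X` enters here, transported along the isomorphism of `X` with the last term of the
  -- angle.
  rw [← cancel_epi e.inv, hX (e.inv ≫ g), comp_zero]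

end Angulation

end Resolution

end

/-! ### Comparison of the two classes of pairs -/

theorem lemma3p11 {k : Type w} [Field k] {C : Type u} [Category.{v} C] [Preadditive C] [Linear k C]
    [HasFiniteBiproducts C] [IsIdempotentComplete C] [∀ X Y : C, Module.Finite k (X ⟶ Y)]
    (n : ℕ) (hn : 1 ≤ n) (𝒜 : Angulation C n) (T : C) (hT : 𝒜.IsClusterTilting T)
    (hrigid : ∀ X : C, Indecomposable X → 𝒜.IsRigid X)
    (M P : FGModuleCat.{v} (End T)ᵐᵒᵖ) :
    IsSupportTauTiltingPair k n (homFunctor k T).essImage M P ↔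
      IsMaximalTauRigidPair k n (homFunctor k T).essImage M P := by
  obtain ⟨m, rfl⟩ := Nat.exists_eq_add_of_le' hn
  refine ⟨fun h => h.isMaximalTauRigidPair (fun _ _ => essImage_prod k) fun A hA => ?_,
    fun h => h.isSupportTauTiltingPair⟩
  obtain ⟨X, ⟨e⟩⟩ := hA
  -- Decomposing in `C` rather than in `mod Λ` keeps the summands in `𝒟` and makes `hrigid`
  -- applicable to them.
  obtain ⟨ι, _, N, s, r, hsr, hN⟩ := exists_indecomposable_decomposition k X
  let e := FGModuleCat.isoToLinearEquiv e
  refine ⟨ι, inferInstance, fun j => (homFunctor k T).obj (N j),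
    fun j => homMap k T (s j) ∘ₗ e.symm.toLinearMap, fun j => e.toLinearMap ∘ₗ homMap k T (r j),
    ?_, fun j => ⟨?_, (homFunctor k T).obj_mem_essImage _,
      hT.isTauRigid k 𝒜 (hrigid _ (hN j).2)⟩⟩
  · refine LinearMap.ext fun x => ?_
    have := congrArg e (LinearMap.congr_fun (homMap_sum_comp k (T := T) s r hsr) (e.symm x))
    simpa only [LinearMap.sum_apply, LinearMap.comp_apply, map_sum, LinearMap.id_apply,
      LinearEquiv.apply_symm_apply, LinearEquiv.coe_coe] using this
  · refine LinearMap.ext fun x => ?_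
    simp only [LinearMap.comp_apply, LinearEquiv.coe_coe, LinearEquiv.symm_apply_apply]
    rw [← LinearMap.comp_apply, homMap_comp, (hN j).1, homMap_id]
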